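/- **Setting.** Let $X\subseteq\mathbb R^n$ be closed and convex, and let $f:\mathbb R^m\to\mathbb R$ and $g:\mathbb R^n\to\mathbb R^m$ be continuously differentiable. Assume that $f$, $g$, $\nabla f$ and the Jacobian $\nabla g$ are Lipschitz continuous, and let $L_g$, $L_{\nabla f}$ be Lipschitz constants of $g$ and $\nabla f$. Norms are Euclidean, with the operator norm for matrices. **NASA method.** Given $a,b,\beta>0$ and $x^0\in X$, $z^0\in\mathbb R^n$, $u^0\in\mathbb R^m$, on a probability space let $\mathcal F_k=\sigma(x^0,\dots,x^k,z^0,\dots,z^k,u^0,\dots,u^k)$. For $k=0,1,2,\dots$, with an $\mathcal F_k$-measurable random stepsize $\tau_k\in(0,1/a]$, put $$y^k=\operatorname*{argmin}_{y\in X}\Big\{\langle z^k,y-x^k\rangle+\tfrac{\beta}{2}\|y-x^k\|^2\Big\},\qquad x^{k+1}=x^k+\tau_k(y^k-x^k),$$ $$z^{k+1}=(1-a\tau_k)z^k+a\tau_k[J^{k+1}]^\top s^{k+1},\qquad u^{k+1}=(1-b\tau_k)u^k+b\tau_kG^{k+1}.$$ Here the oracle outputs $G^{k+1}\in\mathbb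 R^m$, $s^{k+1}\in\mathbb R^m$ and $J^{k+1}\in\mathbb R^{m\times n}$ are square integrable random elements such that, for constants $\sigma_G,\sigma_J,\sigma_s$ and every $k$, $s^{k+1}$ and $J^{k+1}$ are conditionally independent given $\mathcal F_k$, and almost surely $$\mathbb E[G^{k+1}|\mathcal F_k]=g(x^{k+1}),\quad \mathbb E[\|G^{k+1}-g(x^{k+1})\|^2|\mathcal F_k]\le\sigma_G^2,$$ $$\mathbb E[J^{k+1}|\mathcal F_k]=\nabla g(x^{k+1}),\quad \mathbb E[\|J^{k+1}\|^2|\mathcal F_k]\le\sigma_J^2,$$ $$\mathbb E[s^{k+1}|\mathcal F_k]=\nabla f(u^k),\quad \mathbb E[\|s^{k+1}\|^2|\mathcal F_k]\le\sigma_s^2 .$$ **Theorem.** There is a constant $\bar a>0$, depending only on the problem data ($X$, $f$, $g$ and the Lipschitz constants), such that the following holds for every $a\in(0,\bar a)$. Let $b,\beta>0$ be such that, for some constants $c>0$ and $\gamma>0$ with $c\le a\beta$ and $2c\le\gamma b$, $$2(a\beta-c)(\gamma b-2c)\ \ge\ L_g^2\,(aL_{\nabla f}+\gamma)^2 .$$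 Suppose that the stepsizes of the NASA method satisfy $$\sum_{k=1}^\infty\tau_k=+\infty\ \text{ a.s.},\qquad \mathbb E\sum_{k=1}^\infty\tau_k^2<\infty .$$ Then, with probability 1, every accumulation point $(x^*,z^*,u^*)$ of the sequence $\{(x^k,z^k,u^k)\}$ satisfies $$z^*=[\nabla g(x^*)]^\top\nabla f(g(x^*)),\qquad u^*=g(x^*),\qquad -z^*\in\mathcal N_X(x^*),$$ where $\mathcal N_X(x^*)=\{v:\langle v,y-x^*\rangle\le0\ \forall y\in X\}$ is the normal cone to $X$ at $x^*\in X$ (in particular, $x^*\in X$). -/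

import Mathlib

open MeasureTheory Filter Topology
open scoped NNReal ENNReal

/-- The Euclidean space `ℝᵈ`. -/
abbrev Euc (d : ℕ) : Type := EuclideanSpace ℝ (Fin d)

/-- The normal cone (in the sense of convex analysis) to `X` at `x`; it is empty when `x ∉ X`. -/
def normalCone {n : ℕ} (X : Set (Euc n)) (x : Euc n) : Set (Euc n) :=
  {v | x ∈ X ∧ ∀ y ∈ X, inner ℝ v (y - x) ≤ 0}

/-- `y` is a minimizer over `X` of `⟨z, y - x⟩ + (β / 2) ‖y - x‖²`. -/
def IsProxPoint {n : ℕ} (X : Set (Euc n)) (β : ℝ) (x z y : Euc n) : Prop :=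
  y ∈ X ∧ IsMinOn (fun w : Euc n => inner ℝ z (w - x) + β / 2 * ‖w - x‖ ^ 2) X y

/-- The `σ`-algebra `𝓕ₖ` generated by `x⁰, …, xᵏ, z⁰, …, zᵏ, u⁰, …, uᵏ`. -/
abbrev history {Ω : Type*} {n m : ℕ} (x z : ℕ → Ω → Euc n) (u : ℕ → Ω → Euc m) (k : ℕ) :
    MeasurableSpace Ω :=
  ⨆ i : ℕ, ⨆ _ : i ≤ k,
    MeasurableSpace.comap (x i) inferInstance ⊔ MeasurableSpace.comap (z i) inferInstance ⊔
      MeasurableSpace.comap (u i) inferInstance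

/-- The random elements `S` and `T` are conditionally independent given the `σ`-algebra `𝓖`:
`P(S ∈ A, T ∈ B | 𝓖) = P(S ∈ A | 𝓖) P(T ∈ B | 𝓖)` a.s. for all measurable `A`, `B`. -/
def CondIndepGiven {Ω α α' : Type*} [MeasurableSpace Ω] [MeasurableSpace α] [MeasurableSpace α']
    (P : Measure Ω) (𝓖 : MeasurableSpace Ω) (S : Ω → α) (T : Ω → α') : Prop :=
  ∀ (A : Set α) (B : Set α'), MeasurableSet A → MeasurableSet B →
    P[(S ⁻¹' A ∩ T ⁻¹' B).indicator (fun _ => (1 : ℝ)) | 𝓖] =ᵐ[P]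
      P[(S ⁻¹' A).indicator (fun _ => (1 : ℝ)) | 𝓖] * P[(T ⁻¹' B).indicator (fun _ => (1 : ℝ)) | 𝓖]

/-- The sequences `x, y, z, u` are generated by the NASA method with feasible set `X`, starting
points `x0, z0, u0`, parameters `a, b`, regularization coefficients `β k`, stepsizes `τ k`, and
oracle outputs `G (k + 1)`, `J (k + 1)`, `s (k + 1)` (the index `0` of `G, J, s` is not used).
The transpose of the matrix `J` is the adjoint of the corresponding linear map. -/
structure IsNASARun {Ω : Type*} {n m : ℕ} (X : Set (Euc n)) (a b : ℝ)
    (x0 z0 : Euc n) (u0 : Euc m) (β τ : ℕ → Ω → ℝ)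
    (G : ℕ → Ω → Euc m) (J : ℕ → Ω → (Euc n →L[ℝ] Euc m)) (s : ℕ → Ω → Euc m)
    (x y z : ℕ → Ω → Euc n) (u : ℕ → Ω → Euc m) : Prop where
  a_pos : 0 < a
  b_pos : 0 < b
  x0_mem : x0 ∈ X
  init_x : ∀ ω, x 0 ω = x0
  init_z : ∀ ω, z 0 ω = z0
  init_u : ∀ ω, u 0 ω = u0
  β_meas : ∀ k, Measurable[history x z u k] (β k)
  β_pos : ∀ k ω, 0 < β k ω
  τ_meas : ∀ k, Measurable[history x z u k] (τ k)
  τ_pos : ∀ k ω, 0 < τ k ω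
  τ_le : ∀ k ω, τ k ω ≤ 1 / a
  step_y : ∀ k ω, IsProxPoint X (β k ω) (x k ω) (z k ω) (y k ω)
  step_x : ∀ k ω, x (k + 1) ω = x k ω + τ k ω • (y k ω - x k ω)
  step_z : ∀ k ω, z (k + 1) ω = (1 - a * τ k ω) • z k ω
    + (a * τ k ω) • (ContinuousLinearMap.adjoint (J (k + 1) ω)) (s (k + 1) ω)
  step_u : ∀ k ω, u (k + 1) ω = (1 - b * τ k ω) • u k ω + (b * τ k ω) • G (k + 1) ω

/-- The assumptions on the stochastic oracle: measurable, square integrable outputs; conditional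
independence of `s (k + 1)` and `J (k + 1)` given `𝓕ₖ`; unbiasedness; and bounds on the conditional
second moments. The norm of `J` is the operator norm. -/
structure IsNASAOracle {Ω : Type*} [MeasurableSpace Ω] {n m : ℕ} (P : Measure Ω)
    (f : Euc m → ℝ) (g : Euc n → Euc m) (σG σJ σs : ℝ)
    (G : ℕ → Ω → Euc m) (J : ℕ → Ω → (Euc n →L[ℝ] Euc m)) (s : ℕ → Ω → Euc m)
    (x z : ℕ → Ω → Euc n) (u : ℕ → Ω → Euc m) : Prop where
  G_meas : ∀ k, Measurable (G (k + 1))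
  J_meas : ∀ k, Measurable (J (k + 1))
  s_meas : ∀ k, Measurable (s (k + 1))
  G_memLp : ∀ k, MemLp (G (k + 1)) 2 P
  J_memLp : ∀ k, MemLp (J (k + 1)) 2 P
  s_memLp : ∀ k, MemLp (s (k + 1)) 2 P
  condIndep : ∀ k, CondIndepGiven P (history x z u k) (s (k + 1)) (J (k + 1))
  G_mean : ∀ k, P[G (k + 1) | history x z u k] =ᵐ[P] fun ω => g (x (k + 1) ω)
  G_var : ∀ k, P[fun ω => ‖G (k + 1) ω - g (x (k + 1) ω)‖ ^ 2 | history x z u k]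
    ≤ᵐ[P] fun _ => σG ^ 2
  J_mean : ∀ k, P[J (k + 1) | history x z u k] =ᵐ[P] fun ω => fderiv ℝ g (x (k + 1) ω)
  J_sq : ∀ k, P[fun ω => ‖J (k + 1) ω‖ ^ 2 | history x z u k] ≤ᵐ[P] fun _ => σJ ^ 2
  s_mean : ∀ k, P[s (k + 1) | history x z u k] =ᵐ[P] fun ω => gradient f (u k ω)
  s_sq : ∀ k, P[fun ω => ‖s (k + 1) ω‖ ^ 2 | history x z u k] ≤ᵐ[P] fun _ => σs ^ 2

/-!
Write `F = f ∘ g`, `d = y - x` and `e = g(x) - u`, and let `ξ`, `ζ` be the errors of `[J]ᵀ s` and `G`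
as estimates of their conditional means `[∇g(x (k + 1))]ᵀ ∇f(u k)` and `g(x (k + 1))`.

Along a fixed trajectory, the merit function `a F(x) - η(x, z) + (γ / 2) ‖e‖ ^ 2`, with `η` the
optimal value of the subproblem, satisfies
`W (k + 1) ≤ W k - c τ k (‖d‖ ^ 2 + ‖e‖ ^ 2) + (terms linear in the noise) + (summable terms)`
(`IsNASAPath.merit_descent`). If the sums of the linear terms converge and an accumulation point
exists, then `W` does not tend to `-∞`, so `∑ τ k (‖d‖ ^ 2 + ‖e‖ ^ 2) < ∞`; neither a lower bound on
`F` nor boundedness of `X` is needed. As `∑ τ k = ∞` and `d` varies slowly once the noise in `z` is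
compensated, `d → 0` (`IsNASAPath.tendsto_direction`). The sequences `e` and `z - ∇F(x)` are averages
of noise and of vanishing terms, so they tend to `0` as well. In the limit, the variational
inequality for `y` becomes `-z ∈ normalCone X x`.

Stepsizes above `1` are possible when `a < 1`, so the iterates may leave `X`. The inequality
`⟪z + β d, d⟫ ≤ 0` then fails, but only by a multiple of the distance of `x` to `X`, and
`∑ τ k * infDist (x k) X < ∞`.

The convergence of the noise sums is a martingale argument (`ae_exists_tendsto_sum_inner`) in which
the weights need only be square summable almost surely. This allows weights such as `τ k • d k`, which
are bounded along almost every trajectory but have no uniform bound. The conditional mean and second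
moment of `[J]ᵀ s` come from conditional independence (`CondIndepGiven.condExp_bilin`).
-/

/-! ### Recursive inequalities along divergent stepsizes -/

/-- If `h (k + 1) ≤ (1 - t k) h k + t k ε k` with `ε → 0` and `∑ t k = ∞`, then `h → 0`: for every
`δ > 0` the product `(h k - δ)⁺ exp (∑ i < k, t i)` is eventually nonincreasing. -/
theorem tendsto_zero_of_le_contraction {h t ε : ℕ → ℝ} (hh : ∀ k, 0 ≤ h k)
    (ht : ∀ᶠ k in atTop, 0 ≤ t k ∧ t k ≤ 1)
    (hsum : Tendsto (fun N => ∑ k ∈ Finset.range N, t k) atTop atTop)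
    (hε : Tendsto ε atTop (𝓝 0))
    (hrec : ∀ᶠ k in atTop, h (k + 1) ≤ (1 - t k) * h k + t k * ε k) :
    Tendsto h atTop (𝓝 0) := by
  have key : ∀ δ > 0, ∀ᶠ k in atTop, h k < δ := by
    intro δ hδ
    obtain ⟨K, hK⟩ := eventually_atTop.1
      ((ht.and hrec).and (hε.eventually (gt_mem_nhds (half_pos hδ))))
    set S : ℕ → ℝ := fun N => ∑ k ∈ Finset.range N, t k with hS
    set p : ℕ → ℝ := fun k => max (h k - δ / 2) 0 with hp
    have hp0 : ∀ k, 0 ≤ p k := fun k => le_max_right _ _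
    have hdec : ∀ k ≥ K, p k * Real.exp (S k) ≤ p K * Real.exp (S K) := by
      intro k hk
      induction k, hk using Nat.le_induction with
      | base => exact le_rfl
      | succ k hk ih =>
        refine le_trans ?_ ih
        obtain ⟨⟨⟨h0, h1⟩, h2⟩, h3⟩ := hK k hk
        have hpk : p (k + 1) ≤ (1 - t k) * p k := by
          have h4 : h k - δ / 2 ≤ p k := le_max_left _ _
          refine max_le ?_ (mul_nonneg (by linarith) (hp0 k))
          nlinarith
        have hS1 : S (k + 1) = S k + t k := Finset.sum_range_succ _ _
        have hexp : (1 - t k) * Real.exp (t k) ≤ 1 := by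
          have h5 := Real.add_one_le_exp (-t k)
          have h6 : Real.exp (-t k) * Real.exp (t k) = 1 := by
            rw [← Real.exp_add]; simp
          nlinarith [Real.exp_pos (t k)]
        rw [hS1, Real.exp_add]
        calc p (k + 1) * (Real.exp (S k) * Real.exp (t k))
            ≤ ((1 - t k) * p k) * (Real.exp (S k) * Real.exp (t k)) := by gcongr
          _ = ((1 - t k) * Real.exp (t k)) * (p k * Real.exp (S k)) := by ring
          _ ≤ 1 * (p k * Real.exp (S k)) := by
              gcongr
          _ = _ := one_mul _
    have hlim : Tendsto (fun k => p K * Real.exp (S K) * Real.exp (-S k)) atTop (𝓝 0) := by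
      have := (Real.tendsto_exp_neg_atTop_nhds_zero.comp hsum).const_mul (p K * Real.exp (S K))
      simpa using this
    filter_upwards [hlim.eventually (gt_mem_nhds (half_pos hδ)), eventually_ge_atTop K]
      with k hk1 hk2
    have h7 : p k ≤ p K * Real.exp (S K) * Real.exp (-S k) := by
      have h8 := hdec k hk2
      have h9 : Real.exp (S k) * Real.exp (-S k) = 1 := by rw [← Real.exp_add]; simp
      calc p k = p k * Real.exp (S k) * Real.exp (-S k) := by rw [mul_assoc, h9, mul_one]
        _ ≤ _ := by gcongr
    have : h k - δ / 2 ≤ p k := le_max_left _ _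
    linarith
  rw [Metric.tendsto_atTop]
  intro δ hδ
  obtain ⟨K, hK⟩ := eventually_atTop.1 (key δ hδ)
  exact ⟨K, fun k hk => by rw [Real.dist_eq, sub_zero, abs_of_nonneg (hh k)]; exact hK k hk⟩

theorem exists_bound_of_eventually_le {h : ℕ → ℝ} {B : ℝ} (hB : ∀ᶠ k in atTop, h k ≤ B) :
    ∃ C, ∀ k, h k ≤ C := by
  obtain ⟨C, hC⟩ := (isBoundedUnder_of_eventually_le hB).bddAbove_range
  exact ⟨C, fun k => hC ⟨k, rfl⟩⟩

theorem exists_bound_of_le_contraction {h t : ℕ → ℝ} {B : ℝ}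
    (ht : ∀ᶠ k in atTop, 0 ≤ t k ∧ t k ≤ 1)
    (hrec : ∀ᶠ k in atTop, h (k + 1) ≤ (1 - t k) * h k + t k * B) : ∃ C, ∀ k, h k ≤ C := by
  obtain ⟨K, hK⟩ := eventually_atTop.1 (ht.and hrec)
  refine exists_bound_of_eventually_le (B := max (h K) B)
    (eventually_atTop.2 ⟨K, fun k hk => ?_⟩)
  induction k, hk using Nat.le_induction with
  | base => exact le_max_left _ _
  | succ k hk ih =>
    obtain ⟨⟨h0, h1⟩, h2⟩ := hK k hk
    have : B ≤ max (h K) B := le_max_right _ _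
    nlinarith

section Filtering

variable {E : Type*} [NormedAddCommGroup E] [NormedSpace ℝ E]

/-- Averaging removes noise: only the convergence of `∑ t k • ξ k` is needed, because adding the tail
of this series to `e` turns the recursion into one driven by a vanishing perturbation. -/
theorem tendsto_zero_of_averaging {e ε ξ : ℕ → E} {t : ℕ → ℝ} {S : E}
    (ht : ∀ᶠ k in atTop, 0 ≤ t k ∧ t k ≤ 1)
    (hsum : Tendsto (fun N => ∑ k ∈ Finset.range N, t k) atTop atTop)
    (hε : Tendsto ε atTop (𝓝 0))
    (hξ : Tendsto (fun N => ∑ k ∈ Finset.range N, t k • ξ k) atTop (𝓝 S))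
    (hrec : ∀ k, e (k + 1) = (1 - t k) • e k + t k • (ε k + ξ k)) :
    Tendsto e atTop (𝓝 0) := by
  -- the tail of the noise series
  set r : ℕ → E := fun N => S - ∑ k ∈ Finset.range N, t k • ξ k with hr
  have hr0 : Tendsto r atTop (𝓝 0) := by simpa using hξ.const_sub S
  have hrec' : ∀ k, e (k + 1) + r (k + 1) = (1 - t k) • (e k + r k) + t k • (ε k + r k) := by
    intro k
    simp only [hr, hrec k, Finset.sum_range_succ]
    module
  have h1 : Tendsto (fun k => ‖e k + r k‖) atTop (𝓝 0) := by
    refine tendsto_zero_of_le_contraction (fun k => norm_nonneg _) ht hsum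
      (ε := fun k => ‖ε k + r k‖) ?_ ?_
    · simpa using (hε.add hr0).norm
    · filter_upwards [ht] with k hk
      rw [hrec' k]
      refine (norm_add_le _ _).trans ?_
      rw [norm_smul, norm_smul, Real.norm_of_nonneg hk.1, Real.norm_of_nonneg (by linarith [hk.2])]
  simpa using (tendsto_zero_iff_norm_tendsto_zero.2 h1).sub hr0

/-- The bounded counterpart of `tendsto_zero_of_averaging`; here `∑ t k` need not diverge. -/
theorem exists_bound_of_averaging {e ε ξ : ℕ → E} {t : ℕ → ℝ} {S : E} {B : ℝ}
    (ht : ∀ᶠ k in atTop, 0 ≤ t k ∧ t k ≤ 1) (hε : ∀ k, ‖ε k‖ ≤ B)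
    (hξ : Tendsto (fun N => ∑ k ∈ Finset.range N, t k • ξ k) atTop (𝓝 S))
    (hrec : ∀ k, e (k + 1) = (1 - t k) • e k + t k • (ε k + ξ k)) :
    ∃ C, ∀ k, ‖e k‖ ≤ C := by
  set r : ℕ → E := fun N => S - ∑ k ∈ Finset.range N, t k • ξ k with hr
  have hr0 : Tendsto r atTop (𝓝 0) := by simpa using hξ.const_sub S
  obtain ⟨R, hR⟩ := hr0.norm.bddAbove_range
  have hR' : ∀ k, ‖r k‖ ≤ R := fun k => hR ⟨k, rfl⟩
  have hrec' : ∀ k, e (k + 1) + r (k + 1) = (1 - t k) • (e k + r k) + t k • (ε k + r k) := by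
    intro k
    simp only [hr, hrec k, Finset.sum_range_succ]
    module
  obtain ⟨C, hC⟩ : ∃ C, ∀ k, ‖e k + r k‖ ≤ C := by
    refine exists_bound_of_le_contraction (B := B + R) ht ?_
    filter_upwards [ht] with k hk
    rw [hrec' k]
    refine (norm_add_le _ _).trans ?_
    rw [norm_smul, norm_smul, Real.norm_of_nonneg hk.1, Real.norm_of_nonneg (by linarith [hk.2])]
    have h1 := (norm_add_le (ε k) (r k)).trans (add_le_add (hε k) (hR' k))
    have h2 := mul_le_mul_of_nonneg_left h1 hk.1
    linarith
  refine ⟨C + R, fun k => ?_⟩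
  have h3 : e k = (e k + r k) - r k := by abel
  rw [h3]
  exact (norm_sub_le _ _).trans (add_le_add (hC k) (hR' k))

theorem exists_tendsto_sum_mul_smul {v : ℕ → E} {τ : ℕ → ℝ}
    (hv : ∃ S, Tendsto (fun N => ∑ k ∈ Finset.range N, τ k • v k) atTop (𝓝 S)) (c : ℝ) :
    ∃ S, Tendsto (fun N => ∑ k ∈ Finset.range N, (c * τ k) • v k) atTop (𝓝 S) := by
  obtain ⟨S, hS⟩ := hv
  refine ⟨c • S, ?_⟩
  simp only [mul_smul, ← Finset.smul_sum]
  exact hS.const_smul c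

end Filtering

/-- A Lyapunov argument without a lower bound on `W`: it is enough that `W` does not tend to `-∞`.
The perturbation `p` need only have convergent, not absolutely convergent, partial sums. -/
theorem summable_of_lyapunov {W q p s : ℕ → ℝ} {S B : ℝ} (hq : ∀ k, 0 ≤ q k)
    (hs : Summable s) (hp : Tendsto (fun N => ∑ k ∈ Finset.range N, p k) atTop (𝓝 S))
    (hW : ∃ᶠ k in atTop, B ≤ W k)
    (hrec : ∀ k, W (k + 1) ≤ W k - q k + p k + s k) : Summable q := by
  obtain ⟨C, hC⟩ := (hp.add hs.hasSum.tendsto_sum_nat).bddAbove_range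
  have htel : ∀ N, W N + ∑ k ∈ Finset.range N, q k ≤
      W 0 + (∑ k ∈ Finset.range N, p k + ∑ k ∈ Finset.range N, s k) := by
    intro N
    induction N with
    | zero => simp
    | succ N ih =>
      simp only [Finset.sum_range_succ]
      linarith [hrec N]
  refine summable_of_sum_range_le (c := W 0 + C - B) hq fun n => ?_
  obtain ⟨N, hnN, hN⟩ := (frequently_atTop.1 hW) n
  have h1 : ∑ k ∈ Finset.range n, q k ≤ ∑ k ∈ Finset.range N, q k :=
    Finset.sum_le_sum_of_subset_of_nonneg (Finset.range_mono hnN) fun i _ _ => hq i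
  have h2 := htel N
  have h3 := hC ⟨N, rfl⟩
  simp only at h3
  linarith

/-- Under these hypotheses the increments of `p ^ 3` are of order `τ k * p k ^ 2 + τ k ^ 2`, hence
summable, so `p` converges; the divergence of `∑ τ k` leaves `0` as the only possible limit. -/
theorem tendsto_zero_of_summable_mul_sq {p τ : ℕ → ℝ} {C : ℝ} (hp : ∀ k, 0 ≤ p k)
    (hτ : ∀ k, 0 ≤ τ k)
    (hsum : Tendsto (fun N => ∑ k ∈ Finset.range N, τ k) atTop atTop)
    (hsq : Summable fun k => τ k ^ 2) (hsum2 : Summable fun k => τ k * p k ^ 2)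
    (hinc : ∀ k, |p (k + 1) - p k| ≤ C * τ k) : Tendsto p atTop (𝓝 0) := by
  have hC : ∀ k, 0 ≤ C * τ k := fun k => (abs_nonneg _).trans (hinc k)
  obtain ⟨T, hT⟩ := hsq.tendsto_atTop_zero.bddAbove_range
  have hT' : ∀ k, τ k ^ 2 ≤ T := fun k => hT ⟨k, rfl⟩
  have hcauchy : CauchySeq fun k => p k ^ 3 := by
    refine cauchySeq_of_summable_dist (Summable.of_nonneg_of_le (fun k => dist_nonneg)
      (f := fun k => 5 * |C| * (τ k * p k ^ 2) + 3 * |C| ^ 3 * (1 + T) * τ k ^ 2) (fun k => ?_)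
      ((hsum2.mul_left _).add (hsq.mul_left _)))
    rw [dist_comm, Real.dist_eq]
    have h1 : p (k + 1) ^ 3 - p k ^ 3 =
      (p (k + 1) - p k) * (p (k + 1) ^ 2 + p (k + 1) * p k + p k ^ 2) := by ring
    have hpos : 0 ≤ p (k + 1) ^ 2 + p (k + 1) * p k + p k ^ 2 := by
      have := hp k; have := hp (k + 1); positivity
    have h2 : p (k + 1) ^ 2 + p (k + 1) * p k + p k ^ 2 ≤ 5 * p k ^ 2 + 3 * (C * τ k) ^ 2 := by
      have h3 := abs_le.1 (hinc k)
      have h4 : p (k + 1) ≤ p k + C * τ k := by linarith [h3.2]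
      have h5 : p (k + 1) ^ 2 ≤ (p k + C * τ k) ^ 2 := by
        have := hp (k + 1); gcongr
      have h6 : p (k + 1) * p k ≤ (p k + C * τ k) * p k := by
        have := hp k; gcongr
      nlinarith [sq_nonneg (p k - C * τ k), sq_nonneg (p k), sq_nonneg (C * τ k)]
    have hτ3 : τ k ^ 3 ≤ (1 + T) * τ k ^ 2 := by
      have h7 : τ k ≤ 1 + T := by nlinarith [hT' k, sq_nonneg (τ k - 1), hτ k]
      nlinarith [sq_nonneg (τ k)]
    have h8 : C * τ k ≤ |C| * τ k := by
      have := hτ k; gcongr; exact le_abs_self C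
    rw [h1, abs_mul, abs_of_nonneg hpos]
    calc |p (k + 1) - p k| * (p (k + 1) ^ 2 + p (k + 1) * p k + p k ^ 2)
        ≤ (|C| * τ k) * (5 * p k ^ 2 + 3 * (|C| * τ k) ^ 2) := by
          have := hC k
          refine mul_le_mul ((hinc k).trans h8) (h2.trans ?_) hpos (this.trans h8)
          gcongr
      _ = 5 * |C| * (τ k * p k ^ 2) + 3 * |C| ^ 3 * τ k ^ 3 := by ring
      _ ≤ 5 * |C| * (τ k * p k ^ 2) + 3 * |C| ^ 3 * ((1 + T) * τ k ^ 2) := by gcongr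
      _ = _ := by ring
  obtain ⟨l, hl⟩ := cauchySeq_tendsto_of_complete hcauchy
  have hl0 : 0 ≤ l := ge_of_tendsto' hl fun k => pow_nonneg (hp k) 3
  rcases hl0.eq_or_lt with rfl | hlpos
  · rw [Metric.tendsto_atTop] at hl ⊢
    intro δ hδ
    obtain ⟨N, hN⟩ := hl (δ ^ 3) (by positivity)
    refine ⟨N, fun k hk => ?_⟩
    have := hN k hk
    rw [Real.dist_eq, sub_zero, abs_of_nonneg (pow_nonneg (hp k) 3)] at this
    rw [Real.dist_eq, sub_zero, abs_of_nonneg (hp k)]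
    exact lt_of_pow_lt_pow_left₀ 3 hδ.le this
  · exfalso
    obtain ⟨δ, hδ, hδl⟩ : ∃ δ : ℝ, 0 < δ ∧ δ ^ 3 ≤ l := by
      refine ⟨min 1 l, by positivity, ?_⟩
      have h1 : min 1 l ≤ 1 := min_le_left _ _
      have h2 : min 1 l ≤ l := min_le_right _ _
      have h3 : 0 < min 1 l := by positivity
      nlinarith [mul_pos h3 h3]
    have hev : ∀ᶠ k in atTop, δ / 2 ≤ p k := by
      have : (δ / 2) ^ 3 < l := lt_of_lt_of_le (by gcongr; linarith) hδl
      filter_upwards [hl.eventually (lt_mem_nhds this)] with k hk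
      exact (lt_of_pow_lt_pow_left₀ 3 (hp k) hk).le
    have hsumτ : Summable τ := by
      refine Summable.of_norm_bounded_eventually_nat (g := fun k => (δ / 2)⁻¹ ^ 2 * (τ k * p k ^ 2))
        (hsum2.mul_left _) ?_
      filter_upwards [hev] with k hk
      rw [Real.norm_of_nonneg (hτ k)]
      have h1 : 1 ≤ (δ / 2)⁻¹ ^ 2 * p k ^ 2 := by
        rw [← mul_pow]
        refine one_le_pow₀ ?_
        rw [inv_mul_eq_div, le_div_iff₀ (by positivity)]
        linarith
      nlinarith [hτ k]
    exact not_tendsto_nhds_of_tendsto_atTop hsum _ hsumτ.hasSum.tendsto_sum_nat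

/-- `h` itself may jump, as long as it is asymptotic to some `h'` whose increments are `O(τ k)`.
The proof applies `tendsto_zero_of_summable_mul_sq` to `(h' - δ)⁺`, which is eventually at most `h`. -/
theorem tendsto_zero_of_slow_variation {h h' τ : ℕ → ℝ} {C : ℝ} (hh : ∀ k, 0 ≤ h k)
    (hτ : ∀ k, 0 ≤ τ k)
    (hsum : Tendsto (fun N => ∑ k ∈ Finset.range N, τ k) atTop atTop)
    (hsq : Summable fun k => τ k ^ 2) (hsum2 : Summable fun k => τ k * h k ^ 2)
    (hinc : ∀ k, |h' (k + 1) - h' k| ≤ C * τ k)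
    (hdiff : Tendsto (fun k => h' k - h k) atTop (𝓝 0)) : Tendsto h atTop (𝓝 0) := by
  have key : ∀ δ > 0, Tendsto (fun k => max (h' k - δ) 0) atTop (𝓝 0) := by
    intro δ hδ
    refine tendsto_zero_of_summable_mul_sq (C := C) (fun k => le_max_right _ _) hτ hsum hsq ?_ ?_
    · refine Summable.of_norm_bounded_eventually_nat hsum2 ?_
      filter_upwards [hdiff.eventually (gt_mem_nhds hδ)] with k hk
      have h1 : max (h' k - δ) 0 ≤ h k := max_le (by linarith) (hh k)
      have h2 : 0 ≤ max (h' k - δ) 0 := le_max_right _ _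
      have := hτ k
      rw [Real.norm_of_nonneg (by positivity)]
      gcongr
    · intro k
      refine (abs_max_sub_max_le_abs _ _ _).trans ?_
      simpa using hinc k
  rw [Metric.tendsto_atTop]
  intro δ hδ
  have h3 := (key (δ / 3) (by positivity)).eventually (gt_mem_nhds (show 0 < δ / 3 by positivity))
  have h4 := hdiff.eventually (lt_mem_nhds (show -(δ / 3) < 0 by linarith))
  obtain ⟨N, hN⟩ := eventually_atTop.1 (h3.and h4)
  refine ⟨N, fun k hk => ?_⟩
  obtain ⟨h5, h6⟩ := hN k hk
  rw [Real.dist_eq, sub_zero, abs_of_nonneg (hh k)]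
  have : h' k - δ / 3 ≤ max (h' k - δ / 3) 0 := le_max_left _ _
  linarith

/-! ### Projections and the proximal subproblem -/

section Projection

variable {E : Type*} [NormedAddCommGroup E] [InnerProductSpace ℝ E]

theorem exists_convex_projection [CompleteSpace E] {X : Set E} (hne : X.Nonempty)
    (hconv : Convex ℝ X) (hclosed : IsClosed X) :
    ∃ π : E → E, ∀ v, π v ∈ X ∧ ∀ w ∈ X, inner ℝ (v - π v) (w - π v) ≤ 0 := by
  have h : ∀ v, ∃ p, p ∈ X ∧ ∀ w ∈ X, inner ℝ (v - p) (w - p) ≤ 0 := by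
    intro v
    obtain ⟨p, hp, hpv⟩ :=
      exists_norm_eq_iInf_of_complete_convex hne hclosed.isComplete hconv v
    exact ⟨p, hp, (norm_eq_iInf_iff_real_inner_le_zero hconv hp).1 hpv⟩
  choose π hπ using h
  exact ⟨π, hπ⟩

/-- The metric projection onto a convex set is nonexpansive, stated for points characterized by the
projection inequality. -/
theorem norm_sub_le_of_projection_inequalities {X : Set E} {v v' p p' : E} (hp : p ∈ X)
    (hp' : p' ∈ X) (h : ∀ w ∈ X, inner ℝ (v - p) (w - p) ≤ 0)
    (h' : ∀ w ∈ X, inner ℝ (v' - p') (w - p') ≤ 0) : ‖p - p'‖ ≤ ‖v - v'‖ := by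
  have h1 := h p' hp'
  have h2 := h' p hp
  have h3 : ‖p - p'‖ ^ 2 ≤ inner ℝ (v - v') (p - p') := by
    rw [← real_inner_self_eq_norm_sq]
    simp only [inner_sub_left, inner_sub_right] at h1 h2 ⊢
    linarith
  have h4 := real_inner_le_norm (v - v') (p - p')
  by_contra! hlt
  nlinarith [norm_nonneg (v - v'), norm_nonneg (p - p')]

/-- One-sided quadratic bound for `-η`, where `η(x, z) = min_{w ∈ X} ⟪z, w - x⟫ + (β / 2) ‖w - x‖ ^ 2`
has gradient `(-(z + β (y - x)), y - x)`. The only property of `y` that is used is the variational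
inequality tested at the new minimizer `y'`; then the remainder completes to a square. -/
theorem prox_value_decrease {β : ℝ} (hβ : 0 < β) {x z y x' z' y' : E}
    (hvi : 0 ≤ inner ℝ (z + β • (y - x)) (y' - y)) :
    -(inner ℝ z' (y' - x') + β / 2 * ‖y' - x'‖ ^ 2) ≤
      -(inner ℝ z (y - x) + β / 2 * ‖y - x‖ ^ 2) + inner ℝ (z + β • (y - x)) (x' - x)
        - inner ℝ (y - x) (z' - z) + ‖z' - z‖ ^ 2 / (2 * β) := by
  obtain ⟨d, rfl⟩ : ∃ d, y = x + d := ⟨y - x, by abel⟩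
  obtain ⟨δ, rfl⟩ : ∃ δ, y' = x + d + δ := ⟨y' - (x + d), by abel⟩
  obtain ⟨h, rfl⟩ : ∃ h, x' = x + h := ⟨x' - x, by abel⟩
  obtain ⟨D, rfl⟩ : ∃ D, z' = z + D := ⟨z' - z, by abel⟩
  rw [show x + d + δ - (x + h) = d + δ - h by abel, show x + d - x = d by abel,
    show x + h - x = h by abel, show z + D - z = D by abel]
  rw [show x + d + δ - (x + d) = δ by abel, show x + d - x = d by abel] at hvi
  have hsq : 0 ≤ β / 2 * ‖δ - h + β⁻¹ • D‖ ^ 2 := by positivity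
  have key : inner ℝ (z + D) (d + δ - h) + β / 2 * ‖d + δ - h‖ ^ 2
      = (inner ℝ z d + β / 2 * ‖d‖ ^ 2) + inner ℝ (z + β • d) δ + inner ℝ d D
        - inner ℝ (z + β • d) h + β / 2 * ‖δ - h + β⁻¹ • D‖ ^ 2 - ‖D‖ ^ 2 / (2 * β) := by
    simp only [← real_inner_self_eq_norm_sq, inner_add_left, inner_add_right, inner_sub_left,
      inner_sub_right, real_inner_smul_left, real_inner_smul_right]
    rw [real_inner_comm d δ, real_inner_comm d h, real_inner_comm δ h, real_inner_comm d D,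
      real_inner_comm δ D, real_inner_comm h D]
    field_simp
    ring
  linarith

/-- A relaxed step towards a point of `X` contracts the distance to `X`, whether or not `x ∈ X`. -/
theorem infDist_convex_step_le [ProperSpace E] {X : Set E} (hconv : Convex ℝ X)
    (hclosed : IsClosed X) {x y : E} (hy : y ∈ X) {τ : ℝ} (h0 : 0 ≤ τ) (h1 : τ ≤ 1) :
    Metric.infDist (x + τ • (y - x)) X ≤ (1 - τ) * Metric.infDist x X := by
  obtain ⟨p, hp, hpx⟩ := hclosed.exists_infDist_eq_dist ⟨y, hy⟩ x
  have hmem : (1 - τ) • p + τ • y ∈ X := hconv hp hy (by linarith) h0 (by ring)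
  refine (Metric.infDist_le_dist_of_mem hmem).trans ?_
  rw [hpx, dist_eq_norm, dist_eq_norm,
    show x + τ • (y - x) - ((1 - τ) • p + τ • y) = (1 - τ) • (x - p) by module, norm_smul,
    Real.norm_of_nonneg (by linarith)]

end Projection

theorem IsProxPoint.projection_inequality {n : ℕ} {X : Set (Euc n)} (hconv : Convex ℝ X) {β : ℝ}
    (hβ : 0 < β) {x z y : Euc n} (h : IsProxPoint X β x z y) :
    ∀ w ∈ X, inner ℝ ((x - β⁻¹ • z) - y) (w - y) ≤ 0 := by
  refine (norm_eq_iInf_iff_real_inner_le_zero hconv h.1).1 ?_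
  have hsq : ∀ w : Euc n, ‖(x - β⁻¹ • z) - w‖ ^ 2 =
      2 / β * (inner ℝ z (w - x) + β / 2 * ‖w - x‖ ^ 2) + ‖β⁻¹ • z‖ ^ 2 := by
    intro w
    rw [show (x - β⁻¹ • z) - w = -((w - x) + β⁻¹ • z) by abel, norm_neg, norm_add_sq_real,
      real_inner_smul_right, real_inner_comm z]
    field_simp
    ring
  have : Nonempty X := ⟨⟨y, h.1⟩⟩
  refine le_antisymm (le_ciInf fun w => ?_)
    (ciInf_le ⟨0, Set.forall_mem_range.2 fun _ => norm_nonneg _⟩ (⟨y, h.1⟩ : X))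
  have hmin : inner ℝ z (y - x) + β / 2 * ‖y - x‖ ^ 2 ≤
      inner ℝ z (w.1 - x) + β / 2 * ‖w.1 - x‖ ^ 2 := h.2 w.2
  refine le_of_sq_le_sq ?_ (norm_nonneg _)
  rw [hsq, hsq]
  gcongr

theorem IsProxPoint.variational_inequality {n : ℕ} {X : Set (Euc n)} (hconv : Convex ℝ X) {β : ℝ}
    (hβ : 0 < β) {x z y : Euc n} (h : IsProxPoint X β x z y) :
    ∀ w ∈ X, 0 ≤ inner ℝ (z + β • (y - x)) (w - y) := by
  intro w hw
  have h1 := h.projection_inequality hconv hβ w hw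
  rw [show z + β • (y - x) = (-β) • ((x - β⁻¹ • z) - y) by
    have : β * β⁻¹ = 1 := mul_inv_cancel₀ hβ.ne'
    simp only [smul_sub, smul_smul, neg_smul, neg_mul, this, one_smul]; abel, real_inner_smul_left]
  nlinarith

theorem IsProxPoint.eq_projection {n : ℕ} {X : Set (Euc n)} (hconv : Convex ℝ X) {β : ℝ}
    (hβ : 0 < β) {π : Euc n → Euc n}
    (hπ : ∀ v, π v ∈ X ∧ ∀ w ∈ X, inner ℝ (v - π v) (w - π v) ≤ 0)
    {x z y : Euc n} (h : IsProxPoint X β x z y) : y = π (x - β⁻¹ • z) := by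
  have h1 := norm_sub_le_of_projection_inequalities h.1 (hπ (x - β⁻¹ • z)).1
    (h.projection_inequality hconv hβ) (hπ _).2
  rw [sub_self, norm_zero] at h1
  exact sub_eq_zero.1 (norm_le_zero_iff.1 h1)

/-! ### The gradient of the composition -/

section ChainGradient

variable {n m : ℕ}

/-- The vector `[∇g(x)]ᵀ ∇f(w)`. -/
noncomputable def chainGradient (f : Euc m → ℝ) (g : Euc n → Euc m) (x : Euc n) (w : Euc m) :
    Euc n :=
  ContinuousLinearMap.adjoint (fderiv ℝ g x) (gradient f w)

variable {f : Euc m → ℝ} {g : Euc n → Euc m} {Lf Lg Lf' Lg' : ℝ≥0}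

theorem norm_gradient_le_of_lipschitz (hLf : LipschitzWith Lf f) (w : Euc m) :
    ‖gradient f w‖ ≤ Lf := by
  rw [gradient, LinearIsometryEquiv.norm_map]
  exact norm_fderiv_le_of_lipschitz ℝ hLf

theorem norm_chainGradient_le (hLf : LipschitzWith Lf f) (hLg : LipschitzWith Lg g)
    (x : Euc n) (w : Euc m) : ‖chainGradient f g x w‖ ≤ Lg * Lf := by
  refine (ContinuousLinearMap.le_opNorm _ _).trans ?_
  rw [LinearIsometryEquiv.norm_map]
  exact mul_le_mul (norm_fderiv_le_of_lipschitz ℝ hLg) (norm_gradient_le_of_lipschitz hLf w)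
    (norm_nonneg _) Lg.2

theorem norm_chainGradient_sub_le (hLf : LipschitzWith Lf f) (hLg : LipschitzWith Lg g)
    (hLf' : LipschitzWith Lf' (gradient f)) (hLg' : LipschitzWith Lg' (fderiv ℝ g))
    (x x' : Euc n) (w w' : Euc m) :
    ‖chainGradient f g x w - chainGradient f g x' w'‖ ≤
      Lf * Lg' * ‖x - x'‖ + Lg * Lf' * ‖w - w'‖ := by
  have h : chainGradient f g x w - chainGradient f g x' w' =
      ContinuousLinearMap.adjoint (fderiv ℝ g x - fderiv ℝ g x') (gradient f w) +
        ContinuousLinearMap.adjoint (fderiv ℝ g x') (gradient f w - gradient f w') := by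
    simp [chainGradient]
  rw [h]
  refine (norm_add_le _ _).trans (add_le_add ?_ ?_)
  · refine (ContinuousLinearMap.le_opNorm _ _).trans ?_
    rw [LinearIsometryEquiv.norm_map]
    calc _ ≤ (Lg' * ‖x - x'‖) * Lf :=
          mul_le_mul (hLg'.norm_sub_le _ _) (norm_gradient_le_of_lipschitz hLf w)
            (norm_nonneg _) (by positivity)
      _ = _ := by ring
  · refine (ContinuousLinearMap.le_opNorm _ _).trans ?_
    rw [LinearIsometryEquiv.norm_map, mul_assoc]
    exact mul_le_mul (norm_fderiv_le_of_lipschitz ℝ hLg) (hLf'.norm_sub_le _ _)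
      (norm_nonneg _) Lg.2

theorem norm_chainGradient_comp_sub_le (hLf : LipschitzWith Lf f) (hLg : LipschitzWith Lg g)
    (hLf' : LipschitzWith Lf' (gradient f)) (hLg' : LipschitzWith Lg' (fderiv ℝ g))
    (x x' : Euc n) :
    ‖chainGradient f g x (g x) - chainGradient f g x' (g x')‖ ≤
      (Lf * Lg' + Lg * Lf' * Lg) * ‖x - x'‖ := by
  refine (norm_chainGradient_sub_le hLf hLg hLf' hLg' x x' _ _).trans ?_
  have := hLg.norm_sub_le x x'
  calc _ ≤ Lf * Lg' * ‖x - x'‖ + Lg * Lf' * (Lg * ‖x - x'‖) := by gcongr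
    _ = _ := by ring

theorem inner_chainGradient_comp (hf : ContDiff ℝ 1 f) (hg : ContDiff ℝ 1 g) (x h : Euc n) :
    inner ℝ (chainGradient f g x (g x)) h = fderiv ℝ (fun x => f (g x)) x h := by
  have h1 := ((hf.differentiable one_ne_zero (g x)).hasFDerivAt.comp x
    (hg.differentiable one_ne_zero x).hasFDerivAt).fderiv
  rw [show (fun x => f (g x)) = f ∘ g from rfl, h1, chainGradient,
    ContinuousLinearMap.adjoint_inner_left, gradient, InnerProductSpace.toDual_symm_apply]
  rfl

/-- The descent inequality for `F = f ∘ g`, whose gradient at `x` is `chainGradient f g x (g x)`. -/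
theorem comp_le_linearization (hf : ContDiff ℝ 1 f) (hg : ContDiff ℝ 1 g)
    (hLf : LipschitzWith Lf f) (hLg : LipschitzWith Lg g)
    (hLf' : LipschitzWith Lf' (gradient f)) (hLg' : LipschitzWith Lg' (fderiv ℝ g))
    (x x' : Euc n) :
    f (g x') ≤ f (g x) + inner ℝ (chainGradient f g x (g x)) (x' - x) +
      (Lf * Lg' + Lg * Lf' * Lg) * ‖x' - x‖ ^ 2 := by
  set L : ℝ := Lf * Lg' + Lg * Lf' * Lg with hL
  have hdiff : Differentiable ℝ (fun x => f (g x)) :=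
    (hf.differentiable one_ne_zero).comp (hg.differentiable one_ne_zero)
  have hbound : ∀ p ∈ segment ℝ x x',
      ‖fderiv ℝ (fun x => f (g x)) p - fderiv ℝ (fun x => f (g x)) x‖ ≤ L * ‖x' - x‖ := by
    intro p hp
    refine ContinuousLinearMap.opNorm_le_bound _ (by positivity) fun h => ?_
    rw [sub_apply, ← inner_chainGradient_comp hf hg,
      ← inner_chainGradient_comp hf hg, ← inner_sub_left]
    refine (norm_inner_le_norm _ _).trans ?_
    gcongr
    refine (norm_chainGradient_comp_sub_le hLf hLg hLf' hLg' p x).trans ?_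
    gcongr
    exact norm_sub_le_of_mem_segment hp
  have h1 := (convex_segment x x').norm_image_sub_le_of_norm_fderiv_le'
    (fun p _ => hdiff p) hbound (left_mem_segment ℝ x x') (right_mem_segment ℝ x x')
  rw [inner_chainGradient_comp hf hg]
  have h2 := (le_abs_self _).trans h1
  have h3 : L * ‖x' - x‖ * ‖x' - x‖ = L * ‖x' - x‖ ^ 2 := by ring
  linarith

end ChainGradient

/-! ### Descent of the merit function along a trajectory -/

theorem le_of_discriminant {P Q M D e : ℝ} (hP : 0 ≤ P) (hQ : 0 ≤ Q) (_ : 0 ≤ D)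
    (_ : 0 ≤ e) (hM : M ^ 2 ≤ 2 * P * Q) : M * D * e ≤ P * D ^ 2 + Q * e ^ 2 := by
  refine le_of_sq_le_sq ?_ (by positivity)
  have h1 : (M * D * e) ^ 2 = M ^ 2 * (D ^ 2 * e ^ 2) := by ring
  have h2 : M ^ 2 * (D ^ 2 * e ^ 2) ≤ 2 * P * Q * (D ^ 2 * e ^ 2) := by gcongr
  nlinarith [sq_nonneg (P * D ^ 2 - Q * e ^ 2), mul_nonneg (mul_nonneg hP hQ)
    (mul_nonneg (sq_nonneg D) (sq_nonneg e))]

section Path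

variable {n m : ℕ}

/-- A deterministic trajectory of the method. The oracle outputs are written as conditional mean
plus error, `[J (k + 1)]ᵀ s (k + 1) = [∇g(x (k + 1))]ᵀ ∇f(u k) + ξ k` and
`G (k + 1) = g(x (k + 1)) + ζ k`; the errors are arbitrary sequences whose sums weighted by the
stepsizes converge. -/
structure IsNASAPath (X : Set (Euc n)) (f : Euc m → ℝ) (g : Euc n → Euc m) (a b β : ℝ)
    (τ : ℕ → ℝ) (x y z : ℕ → Euc n) (u : ℕ → Euc m) (ξ : ℕ → Euc n) (ζ : ℕ → Euc m) :
    Prop where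
  a_pos : 0 < a
  b_pos : 0 < b
  β_pos : 0 < β
  τ_pos : ∀ k, 0 < τ k
  τ_le : ∀ k, τ k ≤ 1 / a
  tendsto_sum_τ : Tendsto (fun N => ∑ k ∈ Finset.range N, τ k) atTop atTop
  summable_τ_sq : Summable fun k => τ k ^ 2
  step_y : ∀ k, IsProxPoint X β (x k) (z k) (y k)
  step_x : ∀ k, x (k + 1) = x k + τ k • (y k - x k)
  step_z : ∀ k, z (k + 1) = (1 - a * τ k) • z k +
    (a * τ k) • (chainGradient f g (x (k + 1)) (u k) + ξ k)
  step_u : ∀ k, u (k + 1) = (1 - b * τ k) • u k + (b * τ k) • (g (x (k + 1)) + ζ k)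
  noise_z : ∃ S, Tendsto (fun N => ∑ k ∈ Finset.range N, τ k • ξ k) atTop (𝓝 S)
  noise_u : ∃ S, Tendsto (fun N => ∑ k ∈ Finset.range N, τ k • ζ k) atTop (𝓝 S)

namespace IsNASAPath

variable {X : Set (Euc n)} {f : Euc m → ℝ} {g : Euc n → Euc m} {a b β : ℝ}
  {τ : ℕ → ℝ} {x y z : ℕ → Euc n} {u : ℕ → Euc m} {ξ : ℕ → Euc n} {ζ : ℕ → Euc m}
  {Lf Lg Lf' Lg' : ℝ≥0}

theorem eventually_mul_τ_mem (h : IsNASAPath X f g a b β τ x y z u ξ ζ) {c : ℝ} (hc : 0 < c) :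
    ∀ᶠ k in atTop, 0 ≤ c * τ k ∧ c * τ k ≤ 1 := by
  have h1 : Tendsto (fun k => τ k ^ 2) atTop (𝓝 0) := h.summable_τ_sq.tendsto_atTop_zero
  filter_upwards [h1.eventually (gt_mem_nhds (show 0 < (c⁻¹) ^ 2 by positivity))] with k hk
  have h2 : τ k < c⁻¹ := lt_of_pow_lt_pow_left₀ 2 (by positivity) hk
  refine ⟨by have := h.τ_pos k; positivity, ?_⟩
  calc c * τ k ≤ c * c⁻¹ := by gcongr
    _ = 1 := mul_inv_cancel₀ hc.ne'

theorem tendsto_sum_mul_τ (h : IsNASAPath X f g a b β τ x y z u ξ ζ) {c : ℝ} (hc : 0 < c) :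
    Tendsto (fun N => ∑ k ∈ Finset.range N, c * τ k) atTop atTop := by
  simp only [← Finset.mul_sum]
  exact h.tendsto_sum_τ.const_mul_atTop hc

/-- A stepsize may exceed `1` when `a < 1`, so iterates can leave `X`. Since `τ k → 0`, the distance
to `X` is eventually contracted by the factor `1 - τ k`. -/
theorem infDist_step_le (h : IsNASAPath X f g a b β τ x y z u ξ ζ) (hconv : Convex ℝ X)
    (hclosed : IsClosed X) : ∀ᶠ k in atTop,
      Metric.infDist (x (k + 1)) X ≤ (1 - τ k) * Metric.infDist (x k) X := by
  filter_upwards [h.eventually_mul_τ_mem one_pos] with k hk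
  rw [h.step_x k]
  exact infDist_convex_step_le hconv hclosed (h.step_y k).1 (by linarith) (by linarith)

theorem exists_infDist_le (h : IsNASAPath X f g a b β τ x y z u ξ ζ) (hconv : Convex ℝ X)
    (hclosed : IsClosed X) : ∃ C, ∀ k, Metric.infDist (x k) X ≤ C := by
  refine exists_bound_of_le_contraction (t := τ) (B := 0) ?_ ?_
  · simpa using h.eventually_mul_τ_mem one_pos
  · simpa using h.infDist_step_le hconv hclosed

theorem summable_mul_infDist (h : IsNASAPath X f g a b β τ x y z u ξ ζ) (hconv : Convex ℝ X)
    (hclosed : IsClosed X) : Summable fun k => τ k * Metric.infDist (x k) X := by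
  set ρ : ℕ → ℝ := fun k => Metric.infDist (x k) X with hρ
  have hρ0 : ∀ k, 0 ≤ ρ k := fun k => Metric.infDist_nonneg
  refine summable_of_lyapunov (W := ρ) (p := fun _ => 0)
    (s := fun k => max (ρ (k + 1) - ρ k + τ k * ρ k) 0) (S := 0) (B := 0)
    (fun k => mul_nonneg (h.τ_pos k).le (hρ0 k)) ?_ (by simp)
    (Frequently.of_forall hρ0) fun k => ?_
  · refine Summable.of_norm_bounded_eventually_nat (g := fun _ => 0) summable_zero ?_
    filter_upwards [h.infDist_step_le hconv hclosed] with k hk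
    rw [max_eq_right (by simp only [hρ]; linarith), norm_zero]
  · have := le_max_left (ρ (k + 1) - ρ k + τ k * ρ k) 0
    linarith

theorem norm_direction_le (h : IsNASAPath X f g a b β τ x y z u ξ ζ) (hconv : Convex ℝ X)
    (hclosed : IsClosed X) (k : ℕ) :
    ‖y k - x k‖ ≤ β⁻¹ * ‖z k‖ + Metric.infDist (x k) X := by
  have hne : X.Nonempty := ⟨_, (h.step_y k).1⟩
  have hβ := h.β_pos
  obtain ⟨p, hp, hpx⟩ := hclosed.exists_infDist_eq_dist hne (x k)
  obtain ⟨π, hπ⟩ := exists_convex_projection hne hconv hclosed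
  have h1 := norm_sub_le_of_projection_inequalities (h.step_y k).1 (hπ (x k)).1
    ((h.step_y k).projection_inequality hconv h.β_pos) (hπ (x k)).2
  have h2 : ‖π (x k) - x k‖ ≤ Metric.infDist (x k) X := by
    rw [hpx, dist_eq_norm]
    have h3 := (hπ (x k)).2 p hp
    have h4 : ‖x k - π (x k)‖ ^ 2 ≤ inner ℝ (x k - π (x k)) (x k - p) := by
      rw [← real_inner_self_eq_norm_sq]
      have : x k - p = (x k - π (x k)) - (p - π (x k)) := by abel
      rw [this, inner_sub_right (x k - π (x k)) (x k - π (x k))]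
      linarith
    have h5 := real_inner_le_norm (x k - π (x k)) (x k - p)
    rw [norm_sub_rev]
    by_contra! hlt
    nlinarith [norm_nonneg (x k - π (x k)), norm_nonneg (x k - p)]
  have h6 : ‖x k - β⁻¹ • z k - x k‖ = β⁻¹ * ‖z k‖ := by
    rw [show x k - β⁻¹ • z k - x k = -(β⁻¹ • z k) by abel, norm_neg, norm_smul,
      Real.norm_of_nonneg (by positivity)]
  rw [h6] at h1
  calc ‖y k - x k‖ = ‖(y k - π (x k)) + (π (x k) - x k)‖ := by congr 1; abel
    _ ≤ _ := (norm_add_le _ _).trans (add_le_add h1 h2)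

/-- The tracking error `g(x) - u` obeys an averaging recursion with weights `b * τ k`. -/
theorem tracking_step (h : IsNASAPath X f g a b β τ x y z u ξ ζ) (k : ℕ) :
    g (x (k + 1)) - u (k + 1) = (1 - b * τ k) • (g (x k) - u k) + (b * τ k) •
      (((1 - b * τ k) / (b * τ k)) • (g (x (k + 1)) - g (x k)) + -ζ k) := by
  have hne : b * τ k ≠ 0 := (mul_pos h.b_pos (h.τ_pos k)).ne'
  rw [h.step_u k, smul_add (b * τ k) (((1 - b * τ k) / (b * τ k)) • _), smul_smul,
    mul_div_cancel₀ _ hne]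
  module

theorem norm_tracking_drift_le (h : IsNASAPath X f g a b β τ x y z u ξ ζ)
    (hLg : LipschitzWith Lg g) (k : ℕ) :
    ‖((1 - b * τ k) / (b * τ k)) • (g (x (k + 1)) - g (x k))‖ ≤
      (1 + b / a) * Lg / b * ‖y k - x k‖ := by
  have ha := h.a_pos
  have hb := h.b_pos
  have hτ := h.τ_pos k
  have h1 : ‖g (x (k + 1)) - g (x k)‖ ≤ Lg * (τ k * ‖y k - x k‖) := by
    refine (hLg.norm_sub_le _ _).trans (le_of_eq ?_)
    rw [h.step_x k, add_sub_cancel_left, norm_smul, Real.norm_of_nonneg hτ.le]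
  have h2 : |1 - b * τ k| ≤ 1 + b / a := by
    have : b * τ k ≤ b / a := by
      rw [div_eq_mul_one_div]; exact mul_le_mul_of_nonneg_left (h.τ_le k) hb.le
    have : 0 < b * τ k := by positivity
    rw [abs_le]; constructor <;> linarith
  rw [norm_smul, norm_div, Real.norm_of_nonneg (show 0 ≤ b * τ k by positivity), Real.norm_eq_abs]
  calc |1 - b * τ k| / (b * τ k) * ‖g (x (k + 1)) - g (x k)‖
      ≤ (1 + b / a) / (b * τ k) * (Lg * (τ k * ‖y k - x k‖)) := by gcongr
    _ = _ := by field_simp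

/-- All quantities entering the merit function are bounded along a trajectory, although neither `X`
nor the noise is bounded. -/
theorem exists_bound (h : IsNASAPath X f g a b β τ x y z u ξ ζ) (hconv : Convex ℝ X)
    (hclosed : IsClosed X) (hLf : LipschitzWith Lf f) (hLg : LipschitzWith Lg g) :
    ∃ B, 0 ≤ B ∧ ∀ k, ‖z k‖ ≤ B ∧ ‖y k - x k‖ ≤ B ∧ ‖g (x k) - u k‖ ≤ B ∧
      ‖g (x (k + 1)) - u k‖ ≤ B := by
  have ha := h.a_pos
  have hb := h.b_pos
  have hβ := h.β_pos
  obtain ⟨S, hS⟩ := exists_tendsto_sum_mul_smul h.noise_z a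
  obtain ⟨Z, hZ⟩ := exists_bound_of_averaging (h.eventually_mul_τ_mem h.a_pos)
    (fun k => norm_chainGradient_le hLf hLg (x (k + 1)) (u k)) hS h.step_z
  obtain ⟨R, hR⟩ := h.exists_infDist_le hconv hclosed
  have hD : ∀ k, ‖y k - x k‖ ≤ β⁻¹ * Z + R := fun k =>
    (h.norm_direction_le hconv hclosed k).trans (by gcongr; exacts [hZ k, hR k])
  set D := β⁻¹ * Z + R with hDdef
  obtain ⟨S', hS'⟩ := exists_tendsto_sum_mul_smul h.noise_u b
  obtain ⟨T, hT⟩ := exists_bound_of_averaging (e := fun k => g (x k) - u k)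
    (ξ := fun k => -ζ k) (S := -S') (B := (1 + b / a) * Lg / b * D)
    (h.eventually_mul_τ_mem h.b_pos)
    (fun k => (h.norm_tracking_drift_le hLg k).trans (by gcongr; exact hD k))
    (by simpa using hS'.neg) h.tracking_step
  have hD0 : 0 ≤ D := (norm_nonneg _).trans (hD 0)
  have hq : ∀ k, ‖g (x (k + 1)) - u k‖ ≤ T + Lg * (1 / a * D) := by
    intro k
    calc ‖g (x (k + 1)) - u k‖ = ‖(g (x k) - u k) + (g (x (k + 1)) - g (x k))‖ := by
          congr 1; abel
      _ ≤ T + Lg * (1 / a * D) := by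
          refine (norm_add_le _ _).trans (add_le_add (hT k) ((hLg.norm_sub_le _ _).trans ?_))
          rw [h.step_x k, add_sub_cancel_left, norm_smul, Real.norm_of_nonneg (h.τ_pos k).le]
          gcongr
          exacts [h.τ_le k, hD k]
  refine ⟨max (max Z D) (max T (T + Lg * (1 / a * D))), ?_, fun k => ⟨?_, ?_, ?_, ?_⟩⟩
  · exact hD0.trans ((le_max_right _ _).trans (le_max_left _ _))
  · exact (hZ k).trans ((le_max_left _ _).trans (le_max_left _ _))
  · exact (hD k).trans ((le_max_right _ _).trans (le_max_left _ _))
  · exact (hT k).trans ((le_max_left _ _).trans (le_max_right _ _))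
  · exact (hq k).trans ((le_max_right _ _).trans (le_max_right _ _))

/-- The merit function `a F(x) - η(x, z) + (γ / 2) ‖g(x) - u‖²` along a trajectory, where `η(x, z)`
is the optimal value of the subproblem defining `y`. -/
noncomputable def merit (f : Euc m → ℝ) (g : Euc n → Euc m) (a β γ : ℝ) (x y z : Euc n)
    (u : Euc m) : ℝ :=
  a * f (g x) - (inner ℝ z (y - x) + β / 2 * ‖y - x‖ ^ 2) + γ / 2 * ‖g x - u‖ ^ 2

/-- Replaces `⟪z + β d, d⟫ ≤ 0`, which holds for `x k ∈ X` only; the error is summable after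
multiplication by `τ k`, by `summable_mul_infDist`. -/
theorem inner_direction_le (h : IsNASAPath X f g a b β τ x y z u ξ ζ) (hconv : Convex ℝ X)
    (hclosed : IsClosed X) (k : ℕ) :
    inner ℝ (z k + β • (y k - x k)) (y k - x k) ≤
      ‖z k + β • (y k - x k)‖ * Metric.infDist (x k) X := by
  obtain ⟨p, hp, hpx⟩ := hclosed.exists_infDist_eq_dist ⟨_, (h.step_y k).1⟩ (x k)
  have h1 := (h.step_y k).variational_inequality hconv h.β_pos p hp
  have h2 := real_inner_le_norm (z k + β • (y k - x k)) (p - x k)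
  rw [hpx, dist_comm, dist_eq_norm]
  have h3 : p - x k = (p - y k) + (y k - x k) := by abel
  rw [h3, inner_add_right, ← h3] at h2
  linarith

theorem tracking_sq_le (h : IsNASAPath X f g a b β τ x y z u ξ ζ) (hLg : LipschitzWith Lg g)
    {B : ℝ} {k : ℕ} (hd : ‖y k - x k‖ ≤ B) (he : ‖g (x k) - u k‖ ≤ B)
    (hq : ‖g (x (k + 1)) - u k‖ ≤ B) :
    ‖g (x (k + 1)) - u (k + 1)‖ ^ 2 ≤ ‖g (x k) - u k‖ ^ 2
      + 2 * (Lg * (τ k * (‖g (x k) - u k‖ * ‖y k - x k‖)))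
      - 2 * b * (τ k * ‖g (x k) - u k‖ ^ 2)
      + (Lg ^ 2 + 4 * b * Lg + b ^ 2) * (τ k ^ 2 * B ^ 2)
      - 2 * (b * ((1 - b * τ k) * τ k * inner ℝ (g (x (k + 1)) - u k) (ζ k)))
      + b ^ 2 * (τ k ^ 2 * ‖ζ k‖ ^ 2) := by
  have hb := h.b_pos
  have hτ := h.τ_pos k
  have hEsq : ‖g (x (k + 1)) - u (k + 1)‖ ^ 2 = (1 - b * τ k) ^ 2 * ‖g (x (k + 1)) - u k‖ ^ 2
      - 2 * (b * ((1 - b * τ k) * τ k * inner ℝ (g (x (k + 1)) - u k) (ζ k)))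
      + b ^ 2 * (τ k ^ 2 * ‖ζ k‖ ^ 2) := by
    rw [show g (x (k + 1)) - u (k + 1) =
        (1 - b * τ k) • (g (x (k + 1)) - u k) - (b * τ k) • ζ k by rw [h.step_u k]; module,
      norm_sub_sq_real, norm_smul, norm_smul, real_inner_smul_left, real_inner_smul_right,
      mul_pow, mul_pow, Real.norm_eq_abs, Real.norm_eq_abs, sq_abs, sq_abs]
    ring
  rw [hEsq]
  have hw : ‖g (x (k + 1)) - g (x k)‖ ≤ Lg * (τ k * ‖y k - x k‖) := by
    refine (hLg.norm_sub_le _ _).trans (le_of_eq ?_)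
    rw [h.step_x k, add_sub_cancel_left, norm_smul, Real.norm_of_nonneg hτ.le]
  have hqe : g (x (k + 1)) - u k = (g (x k) - u k) + (g (x (k + 1)) - g (x k)) := by abel
  have hqsq := norm_add_sq_real (g (x k) - u k) (g (x (k + 1)) - g (x k))
  rw [← hqe] at hqsq
  have hcross := abs_real_inner_le_norm (g (x k) - u k) (g (x (k + 1)) - g (x k))
  generalize inner ℝ (g (x (k + 1)) - u k) (ζ k) = N
  generalize inner ℝ (g (x k) - u k) (g (x (k + 1)) - g (x k)) = I at *
  generalize hW : ‖g (x (k + 1)) - g (x k)‖ = W at *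
  generalize hQ : ‖g (x (k + 1)) - u k‖ = Q at *
  generalize hE : ‖g (x k) - u k‖ = e at *
  generalize hD : ‖y k - x k‖ = d at *
  generalize ‖ζ k‖ = w
  generalize τ k = t at *
  have hW0 : 0 ≤ W := hW ▸ norm_nonneg _
  have hQ0 : 0 ≤ Q := hQ ▸ norm_nonneg _
  have he0 : 0 ≤ e := hE ▸ norm_nonneg _
  have hd0 : 0 ≤ d := hD ▸ norm_nonneg _
  have hB0 : 0 ≤ B := hd0.trans hd
  have hcross' : |I| ≤ Lg * (t * (e * d)) := by
    calc |I| ≤ e * W := hcross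
      _ ≤ e * (Lg * (t * d)) := by gcongr
      _ = _ := by ring
  have hwsq : W ^ 2 ≤ Lg ^ 2 * (t ^ 2 * B ^ 2) := by
    calc W ^ 2 ≤ (Lg * (t * d)) ^ 2 := by gcongr
      _ = Lg ^ 2 * (t ^ 2 * d ^ 2) := by ring
      _ ≤ _ := by gcongr
  obtain ⟨hcr1, hcr2⟩ := abs_le.1 hcross'
  have hED : e * d ≤ B ^ 2 := by rw [sq]; gcongr
  have h3 : Lg * (t * (e * d)) ≤ Lg * (t * B ^ 2) := by gcongr
  have h2 : e ^ 2 - 2 * (Lg * (t * B ^ 2)) ≤ Q ^ 2 := by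
    linarith [sq_nonneg W]
  have h4 : 2 * b * t * (e ^ 2 - 2 * (Lg * (t * B ^ 2))) ≤ 2 * b * t * Q ^ 2 := by gcongr
  have h5 : b ^ 2 * t ^ 2 * Q ^ 2 ≤ b ^ 2 * t ^ 2 * B ^ 2 := by gcongr
  linarith

theorem prox_value_step_le (h : IsNASAPath X f g a b β τ x y z u ξ ζ) (hconv : Convex ℝ X)
    (hclosed : IsClosed X) (hLf : LipschitzWith Lf f) (hLg : LipschitzWith Lg g)
    {B : ℝ} {k : ℕ} (hz : ‖z k‖ ≤ B) (hd : ‖y k - x k‖ ≤ B) :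
    -(inner ℝ (z (k + 1)) (y (k + 1) - x (k + 1)) + β / 2 * ‖y (k + 1) - x (k + 1)‖ ^ 2) ≤
      -(inner ℝ (z k) (y k - x k) + β / 2 * ‖y k - x k‖ ^ 2)
        - a * τ k * inner ℝ (chainGradient f g (x (k + 1)) (u k)) (y k - x k)
        - a * τ k * inner ℝ (y k - x k) (ξ k) - a * τ k * (β * ‖y k - x k‖ ^ 2)
        + (1 + a) * (B + β * B) * (τ k * Metric.infDist (x k) X)
        + a ^ 2 / β * (Lg * Lf + B) ^ 2 * τ k ^ 2 + a ^ 2 / β * (τ k ^ 2 * ‖ξ k‖ ^ 2) := by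
  have ha := h.a_pos
  have hβ := h.β_pos
  have hτ := h.τ_pos k
  have hρ0 : 0 ≤ Metric.infDist (x k) X := Metric.infDist_nonneg
  have hxx : x (k + 1) - x k = τ k • (y k - x k) := by rw [h.step_x k, add_sub_cancel_left]
  have hzz : z (k + 1) - z k =
      (a * τ k) • (chainGradient f g (x (k + 1)) (u k) + ξ k - z k) := by
    rw [h.step_z k]; module
  have hη := prox_value_decrease h.β_pos (x' := x (k + 1)) (z' := z (k + 1))
    ((h.step_y k).variational_inequality hconv h.β_pos _ (h.step_y (k + 1)).1)
  have hdir : inner ℝ (z k + β • (y k - x k)) (y k - x k) ≤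
      (B + β * B) * Metric.infDist (x k) X := by
    refine (h.inner_direction_le hconv hclosed k).trans ?_
    gcongr
    refine (norm_add_le _ _).trans (add_le_add hz ?_)
    rw [norm_smul, Real.norm_of_nonneg hβ.le]
    gcongr
  have hdir2 : inner ℝ (y k - x k) (z k) + β * ‖y k - x k‖ ^ 2 ≤
      (B + β * B) * Metric.infDist (x k) X := by
    have := hdir
    rwa [inner_add_left, real_inner_smul_left, real_inner_self_eq_norm_sq,
      real_inner_comm] at this
  have hsqz : ‖chainGradient f g (x (k + 1)) (u k) + ξ k - z k‖ ^ 2 ≤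
      2 * (Lg * Lf + B) ^ 2 + 2 * ‖ξ k‖ ^ 2 := by
    have h1 : ‖chainGradient f g (x (k + 1)) (u k) + ξ k - z k‖ ≤ (Lg * Lf + B) + ‖ξ k‖ := by
      rw [add_sub_right_comm]
      refine (norm_add_le _ _).trans (add_le_add ((norm_sub_le _ _).trans ?_) le_rfl)
      exact add_le_add (norm_chainGradient_le hLf hLg _ _) hz
    have h2 := pow_le_pow_left₀ (norm_nonneg _) h1 2
    linarith [sq_nonneg ((Lg * Lf + B) - ‖ξ k‖)]
  rw [hxx, hzz, inner_smul_right, inner_smul_right, norm_smul,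
    Real.norm_of_nonneg (show 0 ≤ a * τ k by positivity), mul_pow, inner_sub_right (y k - x k),
    inner_add_right (y k - x k), real_inner_comm (chainGradient f g (x (k + 1)) (u k))] at hη
  have s2 := mul_le_mul_of_nonneg_left hdir hτ.le
  have s3 := mul_le_mul_of_nonneg_left hdir2 (mul_pos ha hτ).le
  have s5 : (a * τ k) ^ 2 * ‖chainGradient f g (x (k + 1)) (u k) + ξ k - z k‖ ^ 2 / (2 * β) ≤
      a ^ 2 / β * (Lg * Lf + B) ^ 2 * τ k ^ 2 + a ^ 2 / β * (τ k ^ 2 * ‖ξ k‖ ^ 2) := by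
    calc _ ≤ (a * τ k) ^ 2 * (2 * (Lg * Lf + B) ^ 2 + 2 * ‖ξ k‖ ^ 2) / (2 * β) := by gcongr
      _ = _ := by field_simp
  linarith

theorem objective_step_le (h : IsNASAPath X f g a b β τ x y z u ξ ζ) (hf : ContDiff ℝ 1 f)
    (hg : ContDiff ℝ 1 g) (hLf : LipschitzWith Lf f) (hLg : LipschitzWith Lg g)
    (hLf' : LipschitzWith Lf' (gradient f)) (hLg' : LipschitzWith Lg' (fderiv ℝ g))
    {B : ℝ} {k : ℕ} (hd : ‖y k - x k‖ ≤ B) :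
    f (g (x (k + 1))) ≤ f (g (x k)) +
      τ k * inner ℝ (chainGradient f g (x (k + 1)) (u k)) (y k - x k) +
      τ k * (Lg * Lf' * (‖g (x k) - u k‖ * ‖y k - x k‖)) +
      (2 * (Lf * Lg') + Lg * Lf' * Lg) * (τ k ^ 2 * B ^ 2) := by
  have hτ := h.τ_pos k
  have hxx : x (k + 1) - x k = τ k • (y k - x k) := by rw [h.step_x k, add_sub_cancel_left]
  have hF := comp_le_linearization hf hg hLf hLg hLf' hLg' (x k) (x (k + 1))
  rw [hxx, inner_smul_right, norm_smul, Real.norm_of_nonneg hτ.le, mul_pow] at hF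
  have hgrad : inner ℝ (chainGradient f g (x k) (g (x k))) (y k - x k) -
      inner ℝ (chainGradient f g (x (k + 1)) (u k)) (y k - x k) ≤
      Lf * Lg' * (τ k * B ^ 2) + Lg * Lf' * (‖g (x k) - u k‖ * ‖y k - x k‖) := by
    rw [← inner_sub_left]
    refine (real_inner_le_norm _ _).trans ?_
    have h1 := norm_chainGradient_sub_le hLf hLg hLf' hLg' (x k) (x (k + 1)) (g (x k)) (u k)
    rw [← norm_neg (x k - x (k + 1)), neg_sub, hxx, norm_smul, Real.norm_of_nonneg hτ.le] at h1
    calc _ ≤ (Lf * Lg' * (τ k * ‖y k - x k‖) + Lg * Lf' * ‖g (x k) - u k‖) * ‖y k - x k‖ := by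
          gcongr
      _ = Lf * Lg' * (τ k * ‖y k - x k‖ ^ 2) +
          Lg * Lf' * (‖g (x k) - u k‖ * ‖y k - x k‖) := by ring
      _ ≤ _ := by gcongr
  have s4 := mul_le_mul_of_nonneg_left hgrad hτ.le
  have s8 : (Lf * Lg' + Lg * Lf' * Lg) * (τ k ^ 2 * ‖y k - x k‖ ^ 2) ≤
      (Lf * Lg' + Lg * Lf' * Lg) * (τ k ^ 2 * B ^ 2) := by gcongr
  linarith

/-- The merit function decreases by `c τ k (‖d‖ ^ 2 + ‖g(x) - u‖ ^ 2)`, up to terms linear in the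
noise and summable terms. The condition on the parameters makes the terms of first order in
`τ k`, a quadratic form in `(‖d‖, ‖g(x) - u‖)`, at most `-c (‖d‖ ^ 2 + ‖g(x) - u‖ ^ 2)`. -/
theorem merit_descent (h : IsNASAPath X f g a b β τ x y z u ξ ζ) (hconv : Convex ℝ X)
    (hclosed : IsClosed X) (hf : ContDiff ℝ 1 f) (hg : ContDiff ℝ 1 g)
    (hLf : LipschitzWith Lf f) (hLg : LipschitzWith Lg g)
    (hLf' : LipschitzWith Lf' (gradient f)) (hLg' : LipschitzWith Lg' (fderiv ℝ g))
    {c γ : ℝ} (hc : 0 < c) (hγ : 0 < γ) (hc1 : c ≤ a * β) (hc2 : 2 * c ≤ γ * b)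
    (hcond : (Lg : ℝ) ^ 2 * (a * Lf' + γ) ^ 2 ≤ 2 * (a * β - c) * (γ * b - 2 * c))
    {B : ℝ} (hB : ∀ k, ‖z k‖ ≤ B ∧ ‖y k - x k‖ ≤ B ∧ ‖g (x k) - u k‖ ≤ B ∧
      ‖g (x (k + 1)) - u k‖ ≤ B) :
    ∃ K₁ K₂ K₃ K₄ : ℝ, ∀ k,
      merit f g a β γ (x (k + 1)) (y (k + 1)) (z (k + 1)) (u (k + 1)) ≤
        merit f g a β γ (x k) (y k) (z k) (u k)
          - c * (τ k * (‖y k - x k‖ ^ 2 + ‖g (x k) - u k‖ ^ 2))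
          + (-a * (τ k * inner ℝ (y k - x k) (ξ k))
            + -(γ * b) * ((1 - b * τ k) * τ k * inner ℝ (g (x (k + 1)) - u k) (ζ k)))
          + (K₁ * τ k ^ 2 + K₂ * (τ k ^ 2 * ‖ξ k‖ ^ 2) + K₃ * (τ k ^ 2 * ‖ζ k‖ ^ 2)
            + K₄ * (τ k * Metric.infDist (x k) X)) := by
  refine ⟨(a * (2 * (Lf * Lg') + Lg * Lf' * Lg) + γ / 2 * (Lg ^ 2 + 4 * b * Lg + b ^ 2)) * B ^ 2
    + a ^ 2 / β * (Lg * Lf + B) ^ 2, a ^ 2 / β, γ / 2 * b ^ 2, (1 + a) * (B + β * B), fun k => ?_⟩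
  obtain ⟨hz, hd, he, hq⟩ := hB k
  have hτ := h.τ_pos k
  have hF := mul_le_mul_of_nonneg_left
    (h.objective_step_le (k := k) hf hg hLf hLg hLf' hLg' hd) h.a_pos.le
  have hη := h.prox_value_step_le (k := k) hconv hclosed hLf hLg hz hd
  have hE := mul_le_mul_of_nonneg_left (h.tracking_sq_le hLg hd he hq) (half_pos hγ).le
  have hquad := mul_le_mul_of_nonneg_left (le_of_discriminant (P := a * β - c)
    (Q := γ * b - 2 * c) (M := Lg * (a * Lf' + γ)) (D := ‖y k - x k‖) (e := ‖g (x k) - u k‖)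
    (by linarith) (by linarith) (norm_nonneg _) (norm_nonneg _)
    (by rw [mul_pow]; exact hcond)) hτ.le
  have hpos : 0 ≤ c * (τ k * ‖g (x k) - u k‖ ^ 2) := by positivity
  rw [merit, merit]
  linarith

theorem merit_bound_below (h : IsNASAPath X f g a b β τ x y z u ξ ζ) {γ B : ℝ} (hγ : 0 < γ)
    (hB : ∀ k, ‖z k‖ ≤ B ∧ ‖y k - x k‖ ≤ B) (k : ℕ) :
    a * f (g (x k)) - (B * B + β / 2 * B ^ 2) ≤ merit f g a β γ (x k) (y k) (z k) (u k) := by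
  have hβ := h.β_pos
  obtain ⟨hz, hd⟩ := hB k
  have hB0 : 0 ≤ B := (norm_nonneg _).trans hz
  have h1 : inner ℝ (z k) (y k - x k) ≤ B * B :=
    (real_inner_le_norm _ _).trans (by gcongr)
  have h2 : β / 2 * ‖y k - x k‖ ^ 2 ≤ β / 2 * B ^ 2 := by gcongr
  have h3 : 0 ≤ γ / 2 * ‖g (x k) - u k‖ ^ 2 := by positivity
  rw [merit]
  linarith

end IsNASAPath

end Path

/-! ### Stationarity of accumulation points of a trajectory -/

namespace IsNASAPath

variable {n m : ℕ} {X : Set (Euc n)} {f : Euc m → ℝ} {g : Euc n → Euc m} {a b β : ℝ}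
  {τ : ℕ → ℝ} {x y z : ℕ → Euc n} {u : ℕ → Euc m} {ξ : ℕ → Euc n} {ζ : ℕ → Euc m}
  {Lf Lg Lf' Lg' : ℝ≥0}

/-- The direction `y - x` is the image of `(x, z)` under a Lipschitz map, but `z` carries noise. Adding
the tail of the noise series to `z` gives a sequence asymptotic to the directions with increments
`O(τ k)`. -/
theorem tendsto_direction (h : IsNASAPath X f g a b β τ x y z u ξ ζ) (hconv : Convex ℝ X)
    (hclosed : IsClosed X) (hLf : LipschitzWith Lf f) (hLg : LipschitzWith Lg g)
    {B : ℝ} (hB : ∀ k, ‖z k‖ ≤ B ∧ ‖y k - x k‖ ≤ B)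
    (hsum : Summable fun k => τ k * ‖y k - x k‖ ^ 2) :
    Tendsto (fun k => y k - x k) atTop (𝓝 0) := by
  have ha := h.a_pos
  have hβ := h.β_pos
  obtain ⟨π, hπ⟩ := exists_convex_projection ⟨_, (h.step_y 0).1⟩ hconv hclosed
  have hπlip : ∀ v v', ‖π v - π v'‖ ≤ ‖v - v'‖ := fun v v' =>
    norm_sub_le_of_projection_inequalities (hπ v).1 (hπ v').1 (hπ v).2 (hπ v').2
  obtain ⟨S, hS⟩ := exists_tendsto_sum_mul_smul h.noise_z a
  -- the tail of the noise series
  set r : ℕ → Euc n := fun N => S - ∑ k ∈ Finset.range N, (a * τ k) • ξ k with hr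
  have hr0 : Tendsto r atTop (𝓝 0) := by simpa using hS.const_sub S
  set w : ℕ → Euc n := fun k => π (x k - β⁻¹ • (z k + r k)) - x k with hw
  have hwd : ∀ k, ‖w k - (y k - x k)‖ ≤ β⁻¹ * ‖r k‖ := by
    intro k
    rw [hw, (h.step_y k).eq_projection hconv hβ hπ, sub_sub_sub_cancel_right]
    refine (hπlip _ _).trans (le_of_eq ?_)
    rw [show x k - β⁻¹ • (z k + r k) - (x k - β⁻¹ • z k) = -(β⁻¹ • r k) by
      rw [smul_add]; abel, norm_neg, norm_smul, Real.norm_of_nonneg (by positivity)]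
  rw [tendsto_zero_iff_norm_tendsto_zero]
  refine tendsto_zero_of_slow_variation (τ := τ) (h' := fun k => ‖w k‖)
    (C := 2 * B + β⁻¹ * (a * (Lg * Lf + B))) (fun k => norm_nonneg _)
    (fun k => (h.τ_pos k).le) h.tendsto_sum_τ h.summable_τ_sq hsum ?_ ?_
  · intro k
    have hτ := h.τ_pos k
    obtain ⟨hz, hd⟩ := hB k
    have hx : ‖x (k + 1) - x k‖ ≤ τ k * B := by
      rw [h.step_x k, add_sub_cancel_left, norm_smul, Real.norm_of_nonneg hτ.le]
      gcongr
    have hz' : ‖(z (k + 1) + r (k + 1)) - (z k + r k)‖ ≤ (a * τ k) * (Lg * Lf + B) := by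
      have h1 : (z (k + 1) + r (k + 1)) - (z k + r k) =
          (a * τ k) • (chainGradient f g (x (k + 1)) (u k) - z k) := by
        simp only [hr, h.step_z k, Finset.sum_range_succ]
        module
      rw [h1, norm_smul, Real.norm_of_nonneg (by positivity)]
      gcongr
      exact (norm_sub_le _ _).trans (add_le_add (norm_chainGradient_le hLf hLg _ _) hz)
    refine (abs_norm_sub_norm_le _ _).trans ?_
    have h2 : w (k + 1) - w k = (π (x (k + 1) - β⁻¹ • (z (k + 1) + r (k + 1))) -
        π (x k - β⁻¹ • (z k + r k))) - (x (k + 1) - x k) := by simp only [hw]; abel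
    have h3 : ‖(x (k + 1) - β⁻¹ • (z (k + 1) + r (k + 1))) - (x k - β⁻¹ • (z k + r k))‖ ≤
        τ k * B + β⁻¹ * ((a * τ k) * (Lg * Lf + B)) := by
      rw [show (x (k + 1) - β⁻¹ • (z (k + 1) + r (k + 1))) - (x k - β⁻¹ • (z k + r k)) =
        (x (k + 1) - x k) - β⁻¹ • ((z (k + 1) + r (k + 1)) - (z k + r k)) by
          rw [smul_sub]; abel]
      refine (norm_sub_le _ _).trans (add_le_add hx ?_)
      rw [norm_smul, Real.norm_of_nonneg (by positivity)]
      gcongr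
    rw [h2]
    refine (norm_sub_le _ _).trans ?_
    linarith [(hπlip _ _).trans h3]
  · refine squeeze_zero_norm (fun k => (abs_norm_sub_norm_le _ _).trans (hwd k)) ?_
    simpa using hr0.norm.const_mul β⁻¹

theorem tendsto_tracking (h : IsNASAPath X f g a b β τ x y z u ξ ζ) (hLg : LipschitzWith Lg g)
    (hd : Tendsto (fun k => y k - x k) atTop (𝓝 0)) :
    Tendsto (fun k => g (x k) - u k) atTop (𝓝 0) := by
  obtain ⟨S, hS⟩ := exists_tendsto_sum_mul_smul h.noise_u b
  refine tendsto_zero_of_averaging (ξ := fun k => -ζ k) (S := -S)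
    (h.eventually_mul_τ_mem h.b_pos) (h.tendsto_sum_mul_τ h.b_pos) ?_
    (by simpa using hS.neg) h.tracking_step
  refine squeeze_zero_norm (fun k => h.norm_tracking_drift_le hLg k) ?_
  simpa using hd.norm.const_mul ((1 + b / a) * Lg / b)

/-- `z` averages estimates of `∇F`, and `∇F(x k)` drifts by `O(τ k ‖y k - x k‖) = o(τ k)` only. -/
theorem tendsto_gradient_error (h : IsNASAPath X f g a b β τ x y z u ξ ζ)
    (hLf : LipschitzWith Lf f) (hLg : LipschitzWith Lg g)
    (hLf' : LipschitzWith Lf' (gradient f)) (hLg' : LipschitzWith Lg' (fderiv ℝ g))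
    (hd : Tendsto (fun k => y k - x k) atTop (𝓝 0))
    (he : Tendsto (fun k => g (x k) - u k) atTop (𝓝 0)) :
    Tendsto (fun k => z k - chainGradient f g (x k) (g (x k))) atTop (𝓝 0) := by
  have ha := h.a_pos
  obtain ⟨S, hS⟩ := exists_tendsto_sum_mul_smul h.noise_z a
  set V : ℕ → Euc n := fun k => chainGradient f g (x k) (g (x k)) with hV
  have hxx : ∀ k, ‖x (k + 1) - x k‖ = τ k * ‖y k - x k‖ := fun k => by
    rw [h.step_x k, add_sub_cancel_left, norm_smul, Real.norm_of_nonneg (h.τ_pos k).le]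
  refine tendsto_zero_of_averaging (ξ := ξ) (S := S)
    (ε := fun k => (chainGradient f g (x (k + 1)) (u k) - V k) -
      (a * τ k)⁻¹ • (V (k + 1) - V k))
    (h.eventually_mul_τ_mem h.a_pos) (h.tendsto_sum_mul_τ h.a_pos) ?_ hS fun k => ?_
  · refine squeeze_zero_norm (a := fun k => (Lf * Lg' * (1 / a) * ‖y k - x k‖ +
        Lg * Lf' * ‖g (x k) - u k‖) + a⁻¹ * ((Lf * Lg' + Lg * Lf' * Lg) * ‖y k - x k‖))
      (fun k => (norm_sub_le _ _).trans (add_le_add ?_ ?_)) ?_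
    · refine (norm_chainGradient_sub_le hLf hLg hLf' hLg' _ _ _ _).trans (add_le_add ?_ ?_)
      · rw [hxx k, mul_assoc (Lf * Lg' : ℝ)]
        gcongr
        exact h.τ_le k
      · rw [norm_sub_rev]
    · have hτ := h.τ_pos k
      rw [norm_smul, Real.norm_of_nonneg (by positivity)]
      calc (a * τ k)⁻¹ * ‖V (k + 1) - V k‖
          ≤ (a * τ k)⁻¹ * ((Lf * Lg' + Lg * Lf' * Lg) * ‖x (k + 1) - x k‖) := by
            gcongr
            exact norm_chainGradient_comp_sub_le hLf hLg hLf' hLg' _ _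
        _ = _ := by rw [hxx k]; field_simp
    · have := ((hd.norm.const_mul (Lf * Lg' * (1 / a) : ℝ)).add
        (he.norm.const_mul (Lg * Lf' : ℝ))).add
          ((hd.norm.const_mul (Lf * Lg' + Lg * Lf' * Lg : ℝ)).const_mul a⁻¹)
      simpa using this
  · have hne : a * τ k ≠ 0 := (mul_pos ha (h.τ_pos k)).ne'
    rw [h.step_z k, smul_add (a * τ k) (_ - _), smul_sub (a * τ k) _ ((a * τ k)⁻¹ • _), smul_smul,
      mul_inv_cancel₀ hne]
    module

theorem stationary_of_mapClusterPt (h : IsNASAPath X f g a b β τ x y z u ξ ζ)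
    (hconv : Convex ℝ X) (hclosed : IsClosed X) (hf : ContDiff ℝ 1 f) (hg : ContDiff ℝ 1 g)
    (hLf : LipschitzWith Lf f) (hLg : LipschitzWith Lg g)
    (hLf' : LipschitzWith Lf' (gradient f)) (hLg' : LipschitzWith Lg' (fderiv ℝ g))
    {c γ : ℝ} (hc : 0 < c) (hγ : 0 < γ) (hc1 : c ≤ a * β) (hc2 : 2 * c ≤ γ * b)
    (hcond : (Lg : ℝ) ^ 2 * (a * Lf' + γ) ^ 2 ≤ 2 * (a * β - c) * (γ * b - 2 * c))
    (hξ : Summable fun k => τ k ^ 2 * ‖ξ k‖ ^ 2) (hζ : Summable fun k => τ k ^ 2 * ‖ζ k‖ ^ 2)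
    (hdξ : ∃ S, Tendsto (fun N => ∑ k ∈ Finset.range N, τ k * inner ℝ (y k - x k) (ξ k))
      atTop (𝓝 S))
    (hqζ : ∃ S, Tendsto (fun N => ∑ k ∈ Finset.range N,
      (1 - b * τ k) * τ k * inner ℝ (g (x (k + 1)) - u k) (ζ k)) atTop (𝓝 S))
    {xs zs : Euc n} {us : Euc m}
    (hcl : MapClusterPt (xs, zs, us) atTop fun k => (x k, z k, u k)) :
    zs = chainGradient f g xs (g xs) ∧ us = g xs ∧ -zs ∈ normalCone X xs := by
  obtain ⟨B, -, hB⟩ := h.exists_bound hconv hclosed hLf hLg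
  have hB' : ∀ k, ‖z k‖ ≤ B ∧ ‖y k - x k‖ ≤ B := fun k => ⟨(hB k).1, (hB k).2.1⟩
  obtain ⟨U, hU, hlim⟩ := mapClusterPt_iff_ultrafilter.1 hcl
  have hx : Tendsto x U (𝓝 xs) := (continuous_fst.tendsto _).comp hlim
  have hz : Tendsto z U (𝓝 zs) :=
    ((continuous_fst.comp continuous_snd).tendsto (xs, zs, us)).comp hlim
  have hu : Tendsto u U (𝓝 us) :=
    ((continuous_snd.comp continuous_snd).tendsto (xs, zs, us)).comp hlim
  have hgx : Tendsto (fun k => g (x k)) U (𝓝 (g xs)) := (hg.continuous.tendsto _).comp hx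
  -- the merit function does not tend to `-∞`, since `F` is bounded below near `xs`
  have hsum : Summable fun k => c * (τ k * (‖y k - x k‖ ^ 2 + ‖g (x k) - u k‖ ^ 2)) := by
    obtain ⟨K₁, K₂, K₃, K₄, hK⟩ := h.merit_descent hconv hclosed hf hg hLf hLg hLf' hLg' hc hγ
      hc1 hc2 hcond hB
    obtain ⟨S₁, hS₁⟩ := hdξ
    obtain ⟨S₂, hS₂⟩ := hqζ
    refine summable_of_lyapunov
      (W := fun k => merit f g a β γ (x k) (y k) (z k) (u k))
      (B := a * (f (g xs) - 1) - (B * B + β / 2 * B ^ 2)) (fun k => ?_)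
      ((((h.summable_τ_sq.mul_left K₁).add (hξ.mul_left K₂)).add (hζ.mul_left K₃)).add
        ((h.summable_mul_infDist hconv hclosed).mul_left K₄))
      (p := fun k => -a * (τ k * inner ℝ (y k - x k) (ξ k))
            + -(γ * b) * ((1 - b * τ k) * τ k * inner ℝ (g (x (k + 1)) - u k) (ζ k)))
      (S := -a * S₁ + -(γ * b) * S₂) ?_ ?_ hK
    · have := h.τ_pos k
      positivity
    · simp only [Finset.sum_add_distrib, ← Finset.mul_sum]
      exact (hS₁.const_mul _).add (hS₂.const_mul _)
    · have hfx : Tendsto (fun k => f (g (x k))) U (𝓝 (f (g xs))) :=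
        (hf.continuous.tendsto _).comp hgx
      have hev : ∀ᶠ k in (U : Filter ℕ), f (g xs) - 1 ≤ f (g (x k)) :=
        (hfx.eventually (lt_mem_nhds (sub_one_lt _))).mono fun k hk => hk.le
      refine (hev.frequently.filter_mono hU).mono fun k hk => ?_
      refine le_trans ?_ (h.merit_bound_below hγ hB' k)
      have := mul_le_mul_of_nonneg_left hk h.a_pos.le
      linarith
  have hd := h.tendsto_direction hconv hclosed hLf hLg hB' (by
    refine Summable.of_nonneg_of_le (fun k => ?_) (fun k => ?_) (hsum.mul_left c⁻¹)
    · have := h.τ_pos k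
      positivity
    · have := h.τ_pos k
      rw [inv_mul_cancel_left₀ hc.ne']
      gcongr
      exact le_add_of_nonneg_right (by positivity))
  have he := h.tendsto_tracking hLg hd
  have hge := h.tendsto_gradient_error hLf hLg hLf' hLg' hd he
  have hgrad : Tendsto (fun k => chainGradient f g (x k) (g (x k))) U
      (𝓝 (chainGradient f g xs (g xs))) := by
    rw [tendsto_iff_norm_sub_tendsto_zero] at hx ⊢
    refine squeeze_zero (fun k => norm_nonneg _)
      (fun k => norm_chainGradient_comp_sub_le hLf hLg hLf' hLg' _ _) ?_
    simpa using hx.const_mul (Lf * Lg' + Lg * Lf' * Lg : ℝ)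
  have hyx : Tendsto y U (𝓝 xs) := by simpa using (hd.mono_left hU).add hx
  refine ⟨?_, ?_, hclosed.mem_of_tendsto hyx (Eventually.of_forall fun k => (h.step_y k).1),
    fun w hw => ?_⟩
  · exact sub_eq_zero.1 (tendsto_nhds_unique (hz.sub hgrad) (hge.mono_left hU))
  · exact (sub_eq_zero.1 (tendsto_nhds_unique (hgx.sub hu) (he.mono_left hU))).symm
  · have hlim' : Tendsto (fun k => inner ℝ (z k + β • (y k - x k)) (w - y k)) U
        (𝓝 (inner ℝ (zs + β • (0 : Euc n)) (w - xs))) :=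
      (hz.add ((hd.mono_left hU).const_smul β)).inner (hyx.const_sub w)
    have h0 := ge_of_tendsto' hlim' fun k =>
      (h.step_y k).variational_inequality hconv h.β_pos w hw
    rw [smul_zero, add_zero] at h0
    rw [inner_neg_left]
    linarith

end IsNASAPath

/-! ### Conditional independence and products -/

section CondIndep

variable {Ω : Type*} {𝓖 mΩ : MeasurableSpace Ω} {P : Measure Ω}

theorem CondIndepGiven.comp {α α' γ γ' : Type*} [MeasurableSpace α] [MeasurableSpace α']
    [MeasurableSpace γ] [MeasurableSpace γ'] {S : Ω → α} {T : Ω → α'}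
    (h : CondIndepGiven P 𝓖 S T) {φ : α → γ} {ψ : α' → γ'} (hφ : Measurable φ)
    (hψ : Measurable ψ) : CondIndepGiven P 𝓖 (fun ω => φ (S ω)) (fun ω => ψ (T ω)) :=
  fun A B hA hB => h (φ ⁻¹' A) (ψ ⁻¹' B) (hφ hA) (hψ hB)

variable [IsProbabilityMeasure P]

theorem condExp_indicator_one_mem_Icc (h𝓖 : 𝓖 ≤ mΩ) {s : Set Ω} (hs : MeasurableSet s) :
    ∀ᵐ ω ∂P, 0 ≤ (P[s.indicator (fun _ => (1 : ℝ)) | 𝓖]) ω ∧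
      (P[s.indicator (fun _ => (1 : ℝ)) | 𝓖]) ω ≤ 1 := by
  have hint : Integrable (s.indicator (fun _ => (1 : ℝ))) P := (integrable_const 1).indicator hs
  have h0 : 0 ≤ᵐ[P] P[s.indicator (fun _ => (1 : ℝ)) | 𝓖] :=
    condExp_nonneg (ae_of_all _ fun ω => Set.indicator_nonneg (fun _ _ => zero_le_one) ω)
  have h1 : P[s.indicator (fun _ => (1 : ℝ)) | 𝓖] ≤ᵐ[P] P[fun _ => (1 : ℝ) | 𝓖] :=
    condExp_mono hint (integrable_const 1)
      (ae_of_all _ fun ω => Set.indicator_le_self' (fun _ _ => zero_le_one) ω)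
  rw [condExp_const h𝓖] at h1
  filter_upwards [h0, h1] with ω h0 h1 using ⟨h0, h1⟩

variable {α : Type*} [MeasurableSpace α] {S : Ω → α}

theorem CondIndepGiven.measure_inter_eq {α' : Type*} [MeasurableSpace α'] {T : Ω → α'}
    (h : CondIndepGiven P 𝓖 S T) (h𝓖 : 𝓖 ≤ mΩ)
    (hS : Measurable S) (hT : Measurable T) {A : Set Ω} {C : Set α} {B : Set α'}
    (hA : MeasurableSet[𝓖] A) (hC : MeasurableSet C) (hB : MeasurableSet B) :
    P.real (T ⁻¹' B ∩ (A ∩ S ⁻¹' C)) =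
      ∫ ω in T ⁻¹' B ∩ A, (P[(S ⁻¹' C).indicator (fun _ => (1 : ℝ)) | 𝓖]) ω ∂P := by
  have hA' := h𝓖 _ hA
  set p := P[(S ⁻¹' C).indicator (fun _ => (1 : ℝ)) | 𝓖] with hp
  have hSm := hS hC
  have hTm := hT hB
  have hST := hSm.inter hTm
  have hTint : Integrable ((T ⁻¹' B).indicator (fun _ => (1 : ℝ))) P :=
    (integrable_const 1).indicator hTm
  have hpint : Integrable p P := integrable_condExp
  have hpT : p * (T ⁻¹' B).indicator (fun _ => (1 : ℝ)) = (T ⁻¹' B).indicator p := by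
    ext ω
    by_cases hω : ω ∈ T ⁻¹' B <;> simp [hω]
  have hpull := condExp_mul_of_aestronglyMeasurable_left (μ := P) (m := 𝓖) (f := p)
    stronglyMeasurable_condExp.aestronglyMeasurable
    (by rw [hpT]; exact hpint.indicator hTm) hTint
  calc P.real (T ⁻¹' B ∩ (A ∩ S ⁻¹' C))
      = ∫ ω in A, (S ⁻¹' C ∩ T ⁻¹' B).indicator (fun _ => (1 : ℝ)) ω ∂P := by
        rw [setIntegral_indicator hST, setIntegral_const, smul_eq_mul, mul_one]
        congr 1
        ext ω
        simp only [Set.mem_inter_iff]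
        tauto
    _ = ∫ ω in A, (P[(S ⁻¹' C ∩ T ⁻¹' B).indicator (fun _ => (1 : ℝ)) | 𝓖]) ω ∂P :=
        (setIntegral_condExp h𝓖 ((integrable_const (1 : ℝ)).indicator hST) hA).symm
    _ = ∫ ω in A, (P[p * (T ⁻¹' B).indicator (fun _ => (1 : ℝ)) | 𝓖]) ω ∂P :=
        integral_congr_ae (ae_restrict_of_ae ((h C B hC hB).trans hpull.symm))
    _ = ∫ ω in A, (T ⁻¹' B).indicator p ω ∂P := by
        rw [hpT]
        exact setIntegral_condExp h𝓖 (hpint.indicator hTm) hA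
    _ = _ := by rw [setIntegral_indicator hTm, Set.inter_comm]

variable {E : Type*} [NormedAddCommGroup E] [NormedSpace ℝ E] [CompleteSpace E]
  [MeasurableSpace E] [BorelSpace E] [SecondCountableTopology E] {T : Ω → E}

theorem CondIndepGiven.setIntegral_inter_eq (h : CondIndepGiven P 𝓖 S T) (h𝓖 : 𝓖 ≤ mΩ)
    (hS : Measurable S) (hT : Measurable T) (hTint : Integrable T P) {A : Set Ω} {C : Set α}
    (hA : MeasurableSet[𝓖] A) (hC : MeasurableSet C) :
    ∫ ω in A ∩ S ⁻¹' C, T ω ∂P = ∫ ω in A ∩ S ⁻¹' C, (P[T | 𝓖]) ω ∂P := by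
  have hA' := h𝓖 _ hA
  set p := P[(S ⁻¹' C).indicator (fun _ => (1 : ℝ)) | 𝓖] with hp
  have hSm := hS hC
  have hp01 : ∀ᵐ ω ∂P, 0 ≤ p ω ∧ p ω ≤ 1 := condExp_indicator_one_mem_Icc (P := P) h𝓖 hSm
  have hpsm : StronglyMeasurable[𝓖] p := stronglyMeasurable_condExp
  have hpm : Measurable p := (hpsm.mono h𝓖).measurable
  have hSint : Integrable ((S ⁻¹' C).indicator (fun _ => (1 : ℝ))) P :=
    (integrable_const 1).indicator hSm
  have hpint : Integrable p P := integrable_condExp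
  -- the law of `T` on `A ∩ {S ∈ C}` has density `p` with respect to its law on `A`
  have hmeas : Measure.map T (P.restrict (A ∩ S ⁻¹' C)) =
      Measure.map T ((P.restrict A).withDensity fun ω => ((p ω).toNNReal : ℝ≥0∞)) := by
    ext B hB
    rw [Measure.map_apply hT hB, Measure.map_apply hT hB, Measure.restrict_apply (hT hB),
      withDensity_apply _ (hT hB), Measure.restrict_restrict (hT hB), ← ofReal_measureReal,
      h.measure_inter_eq h𝓖 hS hT hA hC hB, ofReal_integral_eq_lintegral_ofReal hpint.integrableOn
      (ae_restrict_of_ae (hp01.mono fun ω hω => hω.1))]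
    rfl
  have hpTint : Integrable (p • T) P := by
    refine Integrable.bdd_smul hTint 1 hpm.aestronglyMeasurable ?_
    filter_upwards [hp01] with ω hω
    rw [Real.norm_of_nonneg hω.1]
    exact hω.2
  have hind : (S ⁻¹' C).indicator (fun _ => (1 : ℝ)) • P[T | 𝓖] =
      (S ⁻¹' C).indicator (P[T | 𝓖]) := by
    ext1 ω
    by_cases hω : ω ∈ S ⁻¹' C <;> simp [hω]
  have hpull1 := condExp_smul_of_aestronglyMeasurable_left (μ := P) (m := 𝓖) (f := p)
    hpsm.aestronglyMeasurable hpTint hTint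
  have hpull2 := condExp_smul_of_aestronglyMeasurable_right (μ := P) (m := 𝓖) (g := P[T | 𝓖])
    hSint (by rw [hind]; exact integrable_condExp.indicator hSm)
    stronglyMeasurable_condExp.aestronglyMeasurable
  calc ∫ ω in A ∩ S ⁻¹' C, T ω ∂P
      = ∫ v, v ∂(Measure.map T (P.restrict (A ∩ S ⁻¹' C))) :=
        (integral_map hT.aemeasurable stronglyMeasurable_id.aestronglyMeasurable).symm
    _ = ∫ ω in A, (p ω).toNNReal • T ω ∂P := by
        rw [hmeas, integral_map (f := fun v => v) hT.aemeasurable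
          stronglyMeasurable_id.aestronglyMeasurable,
          integral_withDensity_eq_integral_smul hpm.real_toNNReal]
    _ = ∫ ω in A, (p • T) ω ∂P := by
        refine integral_congr_ae (ae_restrict_of_ae (hp01.mono fun ω hω => ?_))
        simp only [NNReal.smul_def, Real.coe_toNNReal _ hω.1, Pi.smul_apply']
    _ = ∫ ω in A, (P[p • T | 𝓖]) ω ∂P := (setIntegral_condExp h𝓖 hpTint hA).symm
    _ = ∫ ω in A, (P[(S ⁻¹' C).indicator (fun _ => (1 : ℝ)) • P[T | 𝓖] | 𝓖]) ω ∂P :=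
        integral_congr_ae (ae_restrict_of_ae (hpull1.trans hpull2.symm))
    _ = ∫ ω in A, (S ⁻¹' C).indicator (P[T | 𝓖]) ω ∂P := by
        rw [hind]
        exact setIntegral_condExp h𝓖 (integrable_condExp.indicator hSm) hA
    _ = _ := setIntegral_indicator hSm

/-- Conditional independence as invariance: given `𝓖`, the additional knowledge of `S` does not change
the conditional expectation of `T`. -/
theorem CondIndepGiven.condExp_sup_comap (h : CondIndepGiven P 𝓖 S T) (h𝓖 : 𝓖 ≤ mΩ)
    (hS : Measurable S) (hT : Measurable T) (hTint : Integrable T P) :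
    P[T | 𝓖 ⊔ MeasurableSpace.comap S inferInstance] =ᵐ[P] P[T | 𝓖] := by
  have hle : 𝓖 ⊔ MeasurableSpace.comap S inferInstance ≤ mΩ := sup_le h𝓖 hS.comap_le
  have hgen : 𝓖 ⊔ MeasurableSpace.comap S inferInstance = MeasurableSpace.generateFrom
      {s | ∃ A C, MeasurableSet[𝓖] A ∧ MeasurableSet C ∧ s = A ∩ S ⁻¹' C} := by
    refine le_antisymm (sup_le ?_ ?_) (MeasurableSpace.generateFrom_le ?_)
    · intro A hA
      exact MeasurableSpace.measurableSet_generateFrom ⟨A, Set.univ, hA, .univ, by simp⟩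
    · rintro _ ⟨C, hC, rfl⟩
      exact MeasurableSpace.measurableSet_generateFrom
        ⟨Set.univ, C, @MeasurableSet.univ _ 𝓖, hC, by simp⟩
    · rintro _ ⟨A, C, hA, hC, rfl⟩
      exact @MeasurableSet.inter _ (𝓖 ⊔ MeasurableSpace.comap S inferInstance) _ _
        ((le_sup_left : 𝓖 ≤ _) _ hA)
        ((le_sup_right : MeasurableSpace.comap S inferInstance ≤ _) _ ⟨C, hC, rfl⟩)
  have hpi : IsPiSystem
      {s | ∃ A C, MeasurableSet[𝓖] A ∧ MeasurableSet C ∧ s = A ∩ S ⁻¹' C} := by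
    rintro _ ⟨A, C, hA, hC, rfl⟩ _ ⟨A', C', hA', hC', rfl⟩ -
    exact ⟨A ∩ A', C ∩ C', @MeasurableSet.inter _ 𝓖 _ _ hA hA', hC.inter hC',
      by rw [Set.preimage_inter, Set.inter_inter_inter_comm]⟩
  have hcint : Integrable (P[T | 𝓖]) P := integrable_condExp
  have hall : ∀ s, MeasurableSet[𝓖 ⊔ MeasurableSpace.comap S inferInstance] s →
      ∫ ω in s, (P[T | 𝓖]) ω ∂P = ∫ ω in s, T ω ∂P := by
    intro s hs
    induction s, hs using MeasurableSpace.induction_on_inter hgen hpi with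
    | empty => simp
    | basic s hs =>
      obtain ⟨A, C, hA, hC, rfl⟩ := hs
      exact (h.setIntegral_inter_eq h𝓖 hS hT hTint hA hC).symm
    | compl s hs ih =>
      have h1 := integral_add_compl (hle _ hs) hTint
      have h2 := integral_add_compl (hle _ hs) hcint
      rw [integral_condExp h𝓖, ← h1, ih] at h2
      exact add_left_cancel h2
    | iUnion s hd hs ih =>
      rw [integral_iUnion (fun i => hle _ (hs i)) hd hcint.integrableOn,
        integral_iUnion (fun i => hle _ (hs i)) hd hTint.integrableOn]
      exact tsum_congr ih
  refine (ae_eq_condExp_of_forall_setIntegral_eq hle hTint (fun s _ _ => hcint.integrableOn)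
    (fun s hs _ => hall s hs) ?_).symm
  have hle' : 𝓖 ≤ 𝓖 ⊔ MeasurableSpace.comap S inferInstance := le_sup_left
  exact ((stronglyMeasurable_condExp (m := 𝓖) (f := T) (μ := P)).mono hle').aestronglyMeasurable

variable {F H : Type*} [NormedAddCommGroup F] [NormedSpace ℝ F]
  [MeasurableSpace F] [BorelSpace F] [SecondCountableTopology F]
  [NormedAddCommGroup H] [NormedSpace ℝ H] [CompleteSpace H]

/-- First half of the product formula: condition on `𝓖` and `S`. -/
theorem CondIndepGiven.condExp_bilin_sup_comap (B : F →L[ℝ] E →L[ℝ] H) {S : Ω → F} {T : Ω → E}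
    (h : CondIndepGiven P 𝓖 S T) (h𝓖 : 𝓖 ≤ mΩ) (hS : Measurable S) (hT : Measurable T)
    (hTint : Integrable T P) (hB : Integrable (fun ω => B (S ω) (T ω)) P) :
    P[fun ω => B (S ω) (T ω) | 𝓖 ⊔ MeasurableSpace.comap S inferInstance] =ᵐ[P]
      fun ω => B (S ω) ((P[T | 𝓖]) ω) := by
  have hSm : StronglyMeasurable[𝓖 ⊔ MeasurableSpace.comap S inferInstance] S := by
    have : Measurable[𝓖 ⊔ MeasurableSpace.comap S inferInstance] S :=
      (comap_measurable S).mono le_sup_right le_rfl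
    exact this.stronglyMeasurable
  refine (condExp_bilin_of_stronglyMeasurable_left B hSm hB hTint).trans ?_
  filter_upwards [h.condExp_sup_comap h𝓖 hS hT hTint] with ω hω
  rw [hω]

theorem CondIndepGiven.condExp_bilin [CompleteSpace F] (B : F →L[ℝ] E →L[ℝ] H) {S : Ω → F} {T : Ω → E}
    (h : CondIndepGiven P 𝓖 S T) (h𝓖 : 𝓖 ≤ mΩ) (hS : Measurable S) (hT : Measurable T)
    (hSint : Integrable S P) (hTint : Integrable T P)
    (hB : Integrable (fun ω => B (S ω) (T ω)) P) :
    P[fun ω => B (S ω) (T ω) | 𝓖] =ᵐ[P] fun ω => B ((P[S | 𝓖]) ω) ((P[T | 𝓖]) ω) := by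
  have hle : 𝓖 ⊔ MeasurableSpace.comap S inferInstance ≤ mΩ := sup_le h𝓖 hS.comap_le
  have h1 := h.condExp_bilin_sup_comap B h𝓖 hS hT hTint hB
  have h2 : Integrable (fun ω => B (S ω) ((P[T | 𝓖]) ω)) P := integrable_condExp.congr h1
  calc P[fun ω => B (S ω) (T ω) | 𝓖]
      =ᵐ[P] P[P[fun ω => B (S ω) (T ω) | 𝓖 ⊔ MeasurableSpace.comap S inferInstance] | 𝓖] :=
        (condExp_condExp_of_le le_sup_left hle).symm
    _ =ᵐ[P] P[fun ω => B (S ω) ((P[T | 𝓖]) ω) | 𝓖] := condExp_congr_ae h1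
    _ =ᵐ[P] _ := condExp_bilin_of_aestronglyMeasurable_right B
        stronglyMeasurable_condExp.aestronglyMeasurable h2 hSint

/-- For conditionally independent factors, a bounded conditional mean of one makes the
product of integrable ones integrable. -/
theorem CondIndepGiven.integrable_mul {S T : Ω → ℝ} (h : CondIndepGiven P 𝓖 S T)
    (h𝓖 : 𝓖 ≤ mΩ) (hS : Measurable S) (hT : Measurable T) (hS0 : ∀ ω, 0 ≤ S ω)
    (hT0 : ∀ ω, 0 ≤ T ω) (hSint : Integrable S P) (hTint : Integrable T P) {c : ℝ}
    (hc : P[T | 𝓖] ≤ᵐ[P] fun _ => c) : Integrable (fun ω => S ω * T ω) P := by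
  have hc0 : 0 ≤ c := by
    have h0 : 0 ≤ᵐ[P] P[T | 𝓖] := condExp_nonneg (ae_of_all _ hT0)
    obtain ⟨ω, h1, h2⟩ := (h0.and hc).exists
    exact h1.trans h2
  -- truncation of `S` at height `N`
  have hN : ∀ N : ℕ, Integrable (fun ω => min (S ω) N * T ω) P ∧
      ∫ ω, min (S ω) N * T ω ∂P ≤ c * ∫ ω, S ω ∂P := by
    intro N
    have hm : Measurable fun ω => min (S ω) (N : ℝ) := hS.min measurable_const
    have hbd : ∀ ω, ‖min (S ω) (N : ℝ)‖ ≤ N := fun ω => by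
      rw [Real.norm_of_nonneg (le_min (hS0 ω) (Nat.cast_nonneg _))]
      exact min_le_right _ _
    have hint : Integrable (fun ω => min (S ω) N * T ω) P :=
      hTint.bdd_mul hm.aestronglyMeasurable (ae_of_all _ hbd)
    refine ⟨hint, ?_⟩
    have hind : CondIndepGiven P 𝓖 (fun ω => min (S ω) (N : ℝ)) T :=
      h.comp (φ := fun r => min r (N : ℝ)) (ψ := id) (by fun_prop) measurable_id
    have hcond := hind.condExp_bilin_sup_comap (ContinuousLinearMap.mul ℝ ℝ) h𝓖 hm hT hTint hint
    rw [← integral_condExp (sup_le h𝓖 hm.comap_le), ← integral_const_mul]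
    refine integral_mono_ae integrable_condExp (hSint.const_mul c) ?_
    filter_upwards [hcond, hc] with ω h1 h2
    simp only [ContinuousLinearMap.mul_apply'] at h1
    rw [h1, mul_comm c]
    exact (mul_le_mul_of_nonneg_left h2 (le_min (hS0 ω) (Nat.cast_nonneg _))).trans
      (mul_le_mul_of_nonneg_right (min_le_left _ _) hc0)
  refine ⟨(hS.mul hT).aestronglyMeasurable, ?_⟩
  rw [hasFiniteIntegral_iff_ofReal (ae_of_all _ fun ω => mul_nonneg (hS0 ω) (hT0 ω))]
  have hlim : ∀ ω, Tendsto (fun N : ℕ => ENNReal.ofReal (min (S ω) N * T ω)) atTop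
      (𝓝 (ENNReal.ofReal (S ω * T ω))) := by
    intro ω
    refine tendsto_const_nhds.congr' ?_
    filter_upwards [eventually_ge_atTop ⌈S ω⌉₊] with N hN
    rw [min_eq_left (Nat.ceil_le.1 hN)]
  calc ∫⁻ ω, ENNReal.ofReal (S ω * T ω) ∂P
      = ∫⁻ ω, liminf (fun N : ℕ => ENNReal.ofReal (min (S ω) N * T ω)) atTop ∂P :=
        lintegral_congr fun ω => (hlim ω).liminf_eq.symm
    _ ≤ liminf (fun N : ℕ => ∫⁻ ω, ENNReal.ofReal (min (S ω) N * T ω) ∂P) atTop :=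
        lintegral_liminf_le fun N => ((hS.min measurable_const).mul hT).ennreal_ofReal
    _ ≤ ENNReal.ofReal (c * ∫ ω, S ω ∂P) := by
        refine liminf_le_of_le (by isBoundedDefault) fun b hb => ?_
        obtain ⟨N, hN'⟩ := hb.exists
        refine hN'.trans ?_
        rw [← ofReal_integral_eq_lintegral_ofReal (hN N).1 (ae_of_all _ fun ω =>
          mul_nonneg (le_min (hS0 ω) (Nat.cast_nonneg _)) (hT0 ω))]
        exact ENNReal.ofReal_le_ofReal (hN N).2
    _ < ∞ := ENNReal.ofReal_lt_top

end CondIndep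

/-! ### Convergence of martingale transforms -/

section MartingaleTransform

variable {Ω : Type*} {mΩ : MeasurableSpace Ω} {P : Measure Ω}

theorem integral_mul_le_of_condExp_le [IsProbabilityMeasure P] {𝓖 : MeasurableSpace Ω} (h𝓖 : 𝓖 ≤ mΩ) {φ ψ : Ω → ℝ}
    {C K : ℝ} (hφ : StronglyMeasurable[𝓖] φ) (hφ0 : ∀ ω, 0 ≤ φ ω) (hφK : ∀ ω, φ ω ≤ K)
    (hψ : Integrable ψ P) (hC : P[ψ | 𝓖] ≤ᵐ[P] fun _ => C) :
    Integrable (fun ω => φ ω * ψ ω) P ∧ ∫ ω, φ ω * ψ ω ∂P ≤ C * ∫ ω, φ ω ∂P := by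
  have hφm : AEStronglyMeasurable[mΩ] φ P := (hφ.mono h𝓖).aestronglyMeasurable
  have hbd : ∀ᵐ ω ∂P, ‖φ ω‖ ≤ K := ae_of_all _ fun ω => by
    rw [Real.norm_of_nonneg (hφ0 ω)]; exact hφK ω
  have hint : Integrable (fun ω => φ ω * ψ ω) P := hψ.bdd_mul hφm hbd
  have hφint : Integrable φ P := .of_bound hφm K hbd
  refine ⟨hint, ?_⟩
  have hpull := condExp_mul_of_stronglyMeasurable_left (μ := P) hφ hint hψ
  rw [← integral_condExp h𝓖, ← integral_const_mul]
  refine integral_mono_ae integrable_condExp (hφint.const_mul C) ?_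
  filter_upwards [hpull, hC] with ω h1 h2
  change (P[φ * ψ | 𝓖]) ω ≤ _
  rw [h1, Pi.mul_apply, mul_comm C]
  exact mul_le_mul_of_nonneg_left h2 (hφ0 ω)

variable {F : Type*} [NormedAddCommGroup F] [InnerProductSpace ℝ F] [CompleteSpace F]

theorem condExp_inner_eq_zero {𝓖 : MeasurableSpace Ω} {w ξ : Ω → F}
    (hw : StronglyMeasurable[𝓖] w) (hξ : Integrable ξ P)
    (hint : Integrable (fun ω => inner ℝ (w ω) (ξ ω)) P) (hmean : P[ξ | 𝓖] =ᵐ[P] 0) :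
    P[fun ω => inner ℝ (w ω) (ξ ω) | 𝓖] =ᵐ[P] 0 := by
  have h := condExp_bilin_of_stronglyMeasurable_left (μ := P) (innerSL ℝ) hw hint hξ
  refine h.trans ?_
  filter_upwards [hmean] with ω hω
  simp [hω]

variable [IsProbabilityMeasure P]

/-- The sum of the `⟪w k, ξ k⟫` is an `L²`-bounded martingale when `∑ ‖w k‖ ^ 2` is uniformly bounded. -/
theorem ae_exists_tendsto_sum_inner_of_bound (ℱ : Filtration ℕ mΩ) {w ξ : ℕ → Ω → F} {C K R : ℝ}
    (hw : ∀ k, StronglyMeasurable[ℱ k] (w k)) (hξ : ∀ k, StronglyMeasurable[ℱ (k + 1)] (ξ k))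
    (hξ2 : ∀ k, MemLp (ξ k) 2 P) (hmean : ∀ k, P[ξ k | ℱ k] =ᵐ[P] 0)
    (hvar : ∀ k, P[fun ω => ‖ξ k ω‖ ^ 2 | ℱ k] ≤ᵐ[P] fun _ => C)
    (hwK : ∀ k ω, ‖w k ω‖ ≤ K) (hwR : ∀ N ω, ∑ k ∈ Finset.range N, ‖w k ω‖ ^ 2 ≤ R) :
    ∀ᵐ ω ∂P, ∃ S, Tendsto (fun N => ∑ k ∈ Finset.range N, inner ℝ (w k ω) (ξ k ω))
      atTop (𝓝 S) := by
  have hC0 : 0 ≤ C := by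
    have h0 : 0 ≤ᵐ[P] P[fun ω => ‖ξ 0 ω‖ ^ 2 | ℱ 0] :=
      condExp_nonneg (ae_of_all _ fun ω => sq_nonneg _)
    obtain ⟨ω, h1, h2⟩ := (h0.and (hvar 0)).exists
    exact h1.trans h2
  set D : ℕ → Ω → ℝ := fun k ω => inner ℝ (w k ω) (ξ k ω) with hD
  set M : ℕ → Ω → ℝ := fun N ω => ∑ k ∈ Finset.range N, D k ω with hM
  have hMsucc : ∀ N, M (N + 1) = M N + D N := fun N => by
    ext ω; exact Finset.sum_range_succ _ _
  have hwm : ∀ k, AEStronglyMeasurable (w k) P := fun k =>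
    ((hw k).mono (ℱ.le k)).aestronglyMeasurable
  have hDm : ∀ k, StronglyMeasurable[ℱ (k + 1)] (D k) := fun k =>
    ((hw k).mono (ℱ.mono k.le_succ)).inner (hξ k)
  have hD2 : ∀ k, MemLp (D k) 2 P := fun k =>
    (hξ2 k).of_le_mul (c := K) ((hDm k).mono (ℱ.le _)).aestronglyMeasurable
      (ae_of_all _ fun ω => (norm_inner_le_norm _ _).trans
        (mul_le_mul_of_nonneg_right (hwK k ω) (norm_nonneg _)))
  have hM2 : ∀ N, MemLp (M N) 2 P := fun N => memLp_finsetSum _ fun k _ => hD2 k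
  have hMm : ∀ N, StronglyMeasurable[ℱ N] (M N) := fun N =>
    Finset.stronglyMeasurable_fun_sum _ fun k hk =>
      (hDm k).mono (ℱ.mono (Finset.mem_range.1 hk))
  have hDint : ∀ k, Integrable (D k) P := fun k => (hD2 k).integrable one_le_two
  have hξint : ∀ k, Integrable (ξ k) P := fun k => (hξ2 k).integrable one_le_two
  have hmart : Martingale M ℱ P := by
    refine martingale_of_condExp_sub_eq_zero_nat hMm
      (fun N => (hM2 N).integrable one_le_two) fun N => ?_
    rw [hMsucc, add_sub_cancel_left]
    exact condExp_inner_eq_zero (hw N) (hξint N) (hDint N) (hmean N)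
  -- orthogonality of the increments
  have hcross : ∀ N, ∫ ω, M N ω * D N ω ∂P = 0 := by
    intro N
    have hsm : StronglyMeasurable[ℱ N] fun ω => M N ω • w N ω := (hMm N).smul (hw N)
    have heq : (fun ω => M N ω * D N ω) = fun ω => inner ℝ (M N ω • w N ω) (ξ N ω) := by
      ext ω; rw [real_inner_smul_left]
    have hint : Integrable (fun ω => M N ω * D N ω) P := (hM2 N).integrable_mul (hD2 N)
    rw [heq] at hint ⊢
    rw [← integral_condExp (ℱ.le N),
      integral_congr_ae (condExp_inner_eq_zero hsm (hξint N) hint (hmean N))]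
    simp
  have hDsq : ∀ k, ∫ ω, D k ω ^ 2 ∂P ≤ C * ∫ ω, ‖w k ω‖ ^ 2 ∂P := by
    intro k
    obtain ⟨h1, h2⟩ := integral_mul_le_of_condExp_le (P := P) (ℱ.le k)
      (φ := fun ω => ‖w k ω‖ ^ 2) (K := K ^ 2) ((hw k).norm.pow 2) (fun ω => sq_nonneg _)
      (fun ω => pow_le_pow_left₀ (norm_nonneg _) (hwK k ω) 2) ((hξ2 k).integrable_norm_pow two_ne_zero) (hvar k)
    refine le_trans (integral_mono (hD2 k).integrable_sq h1 fun ω => ?_) h2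
    simp only
    rw [← mul_pow]
    exact sq_le_sq' (neg_le_of_abs_le (abs_real_inner_le_norm _ _))
      ((le_abs_self _).trans (abs_real_inner_le_norm _ _))
  have hwsq : ∀ k, Integrable (fun ω => ‖w k ω‖ ^ 2) P := fun k =>
    .of_bound ((hwm k).norm.pow 2) (K ^ 2) (ae_of_all _ fun ω => by
      rw [Real.norm_of_nonneg (sq_nonneg _)]
      exact pow_le_pow_left₀ (norm_nonneg _) (hwK k ω) 2)
  have hMsq : ∀ N, ∫ ω, M N ω ^ 2 ∂P ≤ C * ∫ ω, ∑ k ∈ Finset.range N, ‖w k ω‖ ^ 2 ∂P := by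
    intro N
    induction N with
    | zero => simp [hM]
    | succ N ih =>
      have h1 : (fun ω => M (N + 1) ω ^ 2) =
          fun ω => (M N ω ^ 2 + 2 * (M N ω * D N ω)) + D N ω ^ 2 := by
        ext ω; rw [hMsucc, Pi.add_apply]; ring
      have hint : Integrable (fun ω => M N ω * D N ω) P := (hM2 N).integrable_mul (hD2 N)
      have hint' : Integrable (fun ω => M N ω ^ 2 + 2 * (M N ω * D N ω)) P :=
        (hM2 N).integrable_sq.add (hint.const_mul 2)
      rw [h1, integral_add hint' (hD2 N).integrable_sq,
        integral_add (hM2 N).integrable_sq (hint.const_mul 2), integral_const_mul, hcross N]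
      simp only [Finset.sum_range_succ]
      rw [integral_add (integrable_finsetSum _ fun k _ => hwsq k) (hwsq N), mul_add]
      linarith [hDsq N]
  have hMR : ∀ N, ∫ ω, M N ω ^ 2 ∂P ≤ C * R := fun N => by
    refine (hMsq N).trans (mul_le_mul_of_nonneg_left ?_ hC0)
    calc _ ≤ ∫ _, R ∂P := integral_mono (integrable_finsetSum _ fun k _ => hwsq k)
          (integrable_const R) (hwR N)
      _ = R := by simp
  have hL1 : ∀ N, eLpNorm (M N) 1 P ≤ ((1 + C * R).toNNReal : ℝ≥0∞) := by
    intro N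
    have hint : Integrable (M N) P := (hM2 N).integrable one_le_two
    rw [eLpNorm_one_eq_lintegral_enorm, ← ofReal_integral_norm_eq_lintegral_enorm hint]
    refine ENNReal.ofReal_le_ofReal ?_
    calc ∫ ω, ‖M N ω‖ ∂P ≤ ∫ ω, (1 + M N ω ^ 2) ∂P := by
          refine integral_mono hint.norm ((integrable_const 1).add (hM2 N).integrable_sq)
            fun ω => ?_
          simp only [Real.norm_eq_abs]
          nlinarith [sq_abs (M N ω), sq_nonneg (|M N ω| - 1), abs_nonneg (M N ω)]
      _ = 1 + ∫ ω, M N ω ^ 2 ∂P := by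
          rw [integral_add (integrable_const 1) (hM2 N).integrable_sq]; simp
      _ ≤ _ := by linarith [hMR N]
  filter_upwards [hmart.submartingale.ae_tendsto_limitProcess hL1] with ω hω
  exact ⟨_, hω⟩

/-- Convergence of a martingale transform with almost surely square summable weights, with no moment
assumption on the weights. The weights are cut off as soon as `∑ ‖w i‖ ^ 2` exceeds a level `R`; this
decision is known at time `k` since `w k` is. -/
theorem ae_exists_tendsto_sum_inner (ℱ : Filtration ℕ mΩ) {w ξ : ℕ → Ω → F} {C : ℝ}
    (hw : ∀ k, StronglyMeasurable[ℱ k] (w k)) (hξ : ∀ k, StronglyMeasurable[ℱ (k + 1)] (ξ k))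
    (hξ2 : ∀ k, MemLp (ξ k) 2 P) (hmean : ∀ k, P[ξ k | ℱ k] =ᵐ[P] 0)
    (hvar : ∀ k, P[fun ω => ‖ξ k ω‖ ^ 2 | ℱ k] ≤ᵐ[P] fun _ => C)
    (hsum : ∀ᵐ ω ∂P, Summable fun k => ‖w k ω‖ ^ 2) :
    ∀ᵐ ω ∂P, ∃ S, Tendsto (fun N => ∑ k ∈ Finset.range N, inner ℝ (w k ω) (ξ k ω))
      atTop (𝓝 S) := by
  set A : ℕ → ℕ → Set Ω := fun R k => {ω | ∑ i ∈ Finset.range (k + 1), ‖w i ω‖ ^ 2 ≤ R} with hA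
  have hAm : ∀ R k, MeasurableSet[ℱ k] (A R k) := fun R k => by
    have h1 : StronglyMeasurable[ℱ k] fun ω => ∑ i ∈ Finset.range (k + 1), ‖w i ω‖ ^ 2 :=
      Finset.stronglyMeasurable_fun_sum _ fun i hi =>
        ((hw i).mono (ℱ.mono (Nat.lt_succ_iff.1 (Finset.mem_range.1 hi)))).norm.pow 2
    exact h1.measurable measurableSet_Iic
  have hind : ∀ R k ω, ‖(A R k).indicator (w k) ω‖ ≤ ‖w k ω‖ := fun R k ω =>
    norm_indicator_le_norm_self _ _
  have hbound : ∀ (R N : ℕ) ω,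
      ∑ k ∈ Finset.range N, ‖(A R k).indicator (w k) ω‖ ^ 2 ≤ R := by
    intro R N ω
    induction N with
    | zero => simp
    | succ N ih =>
      by_cases hω : ω ∈ A R N
      · refine le_trans (Finset.sum_le_sum fun k _ => ?_) hω
        exact pow_le_pow_left₀ (norm_nonneg _) (hind R k ω) 2
      · rw [Finset.sum_range_succ, Set.indicator_of_notMem hω]
        simpa using ih
  have hloc : ∀ R : ℕ, ∀ᵐ ω ∂P, ∃ S, Tendsto (fun N => ∑ k ∈ Finset.range N,
      inner ℝ ((A R k).indicator (w k) ω) (ξ k ω)) atTop (𝓝 S) := by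
    intro R
    refine ae_exists_tendsto_sum_inner_of_bound ℱ (C := C) (K := 1 + R) (R := R)
      (fun k => (hw k).indicator (hAm R k)) hξ hξ2 hmean hvar (fun k ω => ?_) (hbound R)
    have h1 : ‖(A R k).indicator (w k) ω‖ ^ 2 ≤ R := by
      refine le_trans ?_ (hbound R (k + 1) ω)
      exact Finset.single_le_sum (f := fun k => ‖(A R k).indicator (w k) ω‖ ^ 2)
        (fun i _ => sq_nonneg _) (Finset.self_mem_range_succ k)
    nlinarith [sq_nonneg (‖(A R k).indicator (w k) ω‖ - 1)]
  filter_upwards [hsum, ae_all_iff.2 hloc] with ω h1 h2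
  obtain ⟨R, hR⟩ := exists_nat_ge (∑' k, ‖w k ω‖ ^ 2)
  have hmem : ∀ k, ω ∈ A R k := fun k =>
    (h1.sum_le_tsum _ fun i _ => sq_nonneg _).trans hR
  obtain ⟨S, hS⟩ := h2 R
  refine ⟨S, ?_⟩
  simpa only [Set.indicator_of_mem (hmem _)] using hS

end MartingaleTransform

/-! ### Almost sure summability and measurability -/

section Summability

variable {Ω : Type*} {mΩ : MeasurableSpace Ω} {P : Measure Ω}

theorem summable_of_tsum_ofReal_ne_top {f : ℕ → ℝ} (hf : ∀ k, 0 ≤ f k)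
    (h : ∑' k, ENNReal.ofReal (f k) ≠ ∞) : Summable f := by
  have := ENNReal.summable_toReal h
  simpa only [ENNReal.toReal_ofReal (hf _)] using this

theorem ae_summable_of_lintegral_lt_top {φ : ℕ → Ω → ℝ} (hφ : ∀ k, Measurable (φ k))
    (hφ0 : ∀ k ω, 0 ≤ φ k ω)
    (hsum : ∫⁻ ω, ∑' k, ENNReal.ofReal (φ k ω) ∂P < ∞) :
    ∀ᵐ ω ∂P, Summable fun k => φ k ω := by
  have hm : Measurable fun ω => ∑' k, ENNReal.ofReal (φ k ω) :=
    Measurable.tsum fun k => (hφ k).ennreal_ofReal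
  filter_upwards [ae_lt_top hm hsum.ne] with ω hω
  exact summable_of_tsum_ofReal_ne_top (fun k => hφ0 k ω) hω.ne

/-- The expectation of the sum is at most `C` times that of `∑ φ k`. -/
theorem ae_summable_mul_of_condExp_le [IsProbabilityMeasure P] {𝓖 : ℕ → MeasurableSpace Ω}
    (h𝓖 : ∀ k, 𝓖 k ≤ mΩ) {φ ψ : ℕ → Ω → ℝ} {C K : ℝ}
    (hφ : ∀ k, StronglyMeasurable[𝓖 k] (φ k))
    (hφ0 : ∀ k ω, 0 ≤ φ k ω) (hφK : ∀ k ω, φ k ω ≤ K) (hψm : ∀ k, Measurable (ψ k))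
    (hψ0 : ∀ k ω, 0 ≤ ψ k ω) (hψ : ∀ k, Integrable (ψ k) P)
    (hC : ∀ k, P[ψ k | 𝓖 k] ≤ᵐ[P] fun _ => C)
    (hsum : ∫⁻ ω, ∑' k, ENNReal.ofReal (φ k ω) ∂P < ∞) :
    ∀ᵐ ω ∂P, Summable fun k => φ k ω * ψ k ω := by
  have hφm : ∀ k, Measurable (φ k) := fun k => ((hφ k).mono (h𝓖 k)).measurable
  have hφint : ∀ k, Integrable (φ k) P := fun k =>
    .of_bound (hφm k).aestronglyMeasurable K (ae_of_all _ fun ω => by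
      rw [Real.norm_of_nonneg (hφ0 k ω)]; exact hφK k ω)
  refine ae_summable_of_lintegral_lt_top (fun k => (hφm k).mul (hψm k))
    (fun k ω => mul_nonneg (hφ0 k ω) (hψ0 k ω)) ?_
  rw [lintegral_tsum fun k => (hφm k).ennreal_ofReal.aemeasurable] at hsum
  have hprod : ∀ k, Measurable fun ω => φ k ω * ψ k ω := fun k => (hφm k).mul (hψm k)
  rw [lintegral_tsum fun k => (hprod k).ennreal_ofReal.aemeasurable]
  refine lt_of_le_of_lt (ENNReal.tsum_le_tsum (g := fun k =>
    ENNReal.ofReal C * ∫⁻ ω, ENNReal.ofReal (φ k ω) ∂P) fun k => ?_) ?_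
  · obtain ⟨h1, h2⟩ := integral_mul_le_of_condExp_le (h𝓖 k) (hφ k) (hφ0 k) (hφK k) (hψ k) (hC k)
    rw [← ofReal_integral_eq_lintegral_ofReal h1
      (ae_of_all _ fun ω => mul_nonneg (hφ0 k ω) (hψ0 k ω)),
      ← ofReal_integral_eq_lintegral_ofReal (hφint k) (ae_of_all _ (hφ0 k)),
      ← ENNReal.ofReal_mul' (integral_nonneg (hφ0 k))]
    exact ENNReal.ofReal_le_ofReal h2
  · rw [ENNReal.tsum_mul_left]
    exact ENNReal.mul_lt_top ENNReal.ofReal_lt_top hsum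

theorem exists_tendsto_of_inner {d : ℕ} {v : ℕ → Euc d}
    (h : ∀ i, ∃ S, Tendsto (fun N => inner ℝ (EuclideanSpace.basisFun (Fin d) ℝ i) (v N))
      atTop (𝓝 S)) : ∃ S, Tendsto v atTop (𝓝 S) := by
  choose S hS using h
  refine ⟨∑ i, S i • EuclideanSpace.basisFun (Fin d) ℝ i, ?_⟩
  have h1 : v = fun N => ∑ i, inner ℝ (EuclideanSpace.basisFun (Fin d) ℝ i) (v N) •
      EuclideanSpace.basisFun (Fin d) ℝ i := by
    ext1 N
    exact ((EuclideanSpace.basisFun (Fin d) ℝ).sum_repr' (v N)).symm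
  rw [h1]
  exact tendsto_finsetSum _ fun i _ => (hS i).smul_const _

theorem ae_exists_tendsto_sum_smul [IsProbabilityMeasure P] (ℱ : Filtration ℕ mΩ) {d : ℕ}
    {τ : ℕ → Ω → ℝ} {ξ : ℕ → Ω → Euc d} {C : ℝ} (hτ : ∀ k, StronglyMeasurable[ℱ k] (τ k))
    (hξ : ∀ k, StronglyMeasurable[ℱ (k + 1)] (ξ k)) (hξ2 : ∀ k, MemLp (ξ k) 2 P)
    (hmean : ∀ k, P[ξ k | ℱ k] =ᵐ[P] 0)
    (hvar : ∀ k, P[fun ω => ‖ξ k ω‖ ^ 2 | ℱ k] ≤ᵐ[P] fun _ => C)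
    (hsum : ∀ᵐ ω ∂P, Summable fun k => τ k ω ^ 2) :
    ∀ᵐ ω ∂P, ∃ S, Tendsto (fun N => ∑ k ∈ Finset.range N, τ k ω • ξ k ω) atTop (𝓝 S) := by
  have h : ∀ i, ∀ᵐ ω ∂P, ∃ S, Tendsto (fun N => ∑ k ∈ Finset.range N,
      inner ℝ (τ k ω • EuclideanSpace.basisFun (Fin d) ℝ i) (ξ k ω)) atTop (𝓝 S) := by
    intro i
    refine ae_exists_tendsto_sum_inner ℱ (fun k => (hτ k).smul_const _) hξ hξ2 hmean hvar ?_
    filter_upwards [hsum] with ω hω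
    simpa [norm_smul, mul_pow] using hω
  filter_upwards [ae_all_iff.2 h] with ω hω
  refine exists_tendsto_of_inner fun i => ?_
  simpa only [inner_sum, real_inner_smul_left, real_inner_smul_right] using hω i

end Summability

section History

variable {Ω : Type*} {n m : ℕ} {x z : ℕ → Ω → Euc n} {u : ℕ → Ω → Euc m}

theorem history_mono : Monotone (history x z u) := fun _ _ hij =>
  iSup_mono fun _ => iSup_mono' fun h => ⟨h.trans hij, le_rfl⟩

theorem le_history {i k : ℕ} (hik : i ≤ k) :
    MeasurableSpace.comap (x i) inferInstance ⊔ MeasurableSpace.comap (z i) inferInstance ⊔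
      MeasurableSpace.comap (u i) inferInstance ≤ history x z u k :=
  le_iSup₂ (f := fun i (_ : i ≤ k) =>
    MeasurableSpace.comap (x i) inferInstance ⊔ MeasurableSpace.comap (z i) inferInstance ⊔
      MeasurableSpace.comap (u i) inferInstance) i hik

theorem measurable_history_x {i k : ℕ} (hik : i ≤ k) : Measurable[history x z u k] (x i) :=
  measurable_iff_comap_le.2 ((le_sup_left.trans le_sup_left).trans (le_history hik))

theorem measurable_history_z {i k : ℕ} (hik : i ≤ k) : Measurable[history x z u k] (z i) :=
  measurable_iff_comap_le.2 ((le_sup_right.trans le_sup_left).trans (le_history hik))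

theorem measurable_history_u {i k : ℕ} (hik : i ≤ k) : Measurable[history x z u k] (u i) :=
  measurable_iff_comap_le.2 (le_sup_right.trans (le_history hik))

theorem history_le [mΩ : MeasurableSpace Ω] {k : ℕ} (hx : ∀ i ≤ k, Measurable (x i))
    (hz : ∀ i ≤ k, Measurable (z i)) (hu : ∀ i ≤ k, Measurable (u i)) :
    history x z u k ≤ mΩ :=
  iSup₂_le fun i hi => sup_le (sup_le (hx i hi).comap_le (hz i hi).comap_le) (hu i hi).comap_le

end History

/-- The bilinear map `(s, J) ↦ Jᵀ s`. -/
noncomputable def transposeApply (n m : ℕ) : Euc m →L[ℝ] (Euc n →L[ℝ] Euc m) →L[ℝ] Euc n :=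
  LinearMap.mkContinuous₂
    (LinearMap.mk₂ ℝ (fun (s : Euc m) (J : Euc n →L[ℝ] Euc m) => ContinuousLinearMap.adjoint J s)
      (fun _ _ _ => map_add _ _ _) (fun _ _ _ => map_smul _ _ _)
      (fun _ _ _ => by simp) (fun _ _ _ => by simp))
    1 fun s J => by
      rw [LinearMap.mk₂_apply, one_mul, mul_comm]
      refine (ContinuousLinearMap.le_opNorm _ _).trans (le_of_eq ?_)
      rw [LinearIsometryEquiv.norm_map]

theorem transposeApply_apply {n m : ℕ} (s : Euc m) (J : Euc n →L[ℝ] Euc m) :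
    transposeApply n m s J = ContinuousLinearMap.adjoint J s := rfl

theorem stronglyMeasurable_bilin {Ω E F H : Type*} [MeasurableSpace Ω] [NormedAddCommGroup E]
    [NormedSpace ℝ E] [NormedAddCommGroup F] [NormedSpace ℝ F] [NormedAddCommGroup H]
    [NormedSpace ℝ H] (B : E →L[ℝ] F →L[ℝ] H) {s : Ω → E} {J : Ω → F}
    (hs : StronglyMeasurable s) (hJ : StronglyMeasurable J) :
    StronglyMeasurable fun ω => B (s ω) (J ω) :=
  B.continuous₂.comp_stronglyMeasurable (hs.prodMk hJ)

theorem measurable_adjoint_apply {Ω : Type*} [MeasurableSpace Ω] {n m : ℕ}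
    {J : Ω → (Euc n →L[ℝ] Euc m)} {s : Ω → Euc m} (hJ : Measurable J) (hs : Measurable s) :
    Measurable fun ω => ContinuousLinearMap.adjoint (J ω) (s ω) := by
  have h : StronglyMeasurable fun ω => transposeApply n m (s ω) (J ω) :=
    stronglyMeasurable_bilin (transposeApply n m) hs.stronglyMeasurable hJ.stronglyMeasurable
  exact h.measurable

/-! ### The method as a random process -/

theorem measurable_chainGradient {Ω : Type*} {_ : MeasurableSpace Ω} {n m : ℕ} {f : Euc m → ℝ}
    {g : Euc n → Euc m} (hf : Continuous (gradient f)) (hg : Continuous (fderiv ℝ g))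
    {v : Ω → Euc n} {w : Ω → Euc m} (hv : Measurable v) (hw : Measurable w) :
    Measurable fun ω => chainGradient f g (v ω) (w ω) :=
  measurable_adjoint_apply (hg.measurable.comp hv) (hf.measurable.comp hw)

/-- The error of `[J]ᵀ s` as an estimate of its conditional mean. -/
noncomputable def gradientNoise {Ω : Type*} {n m : ℕ} (f : Euc m → ℝ) (g : Euc n → Euc m)
    (J : ℕ → Ω → (Euc n →L[ℝ] Euc m)) (s : ℕ → Ω → Euc m) (x : ℕ → Ω → Euc n) (u : ℕ → Ω → Euc m)
    (k : ℕ) (ω : Ω) : Euc n :=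
  ContinuousLinearMap.adjoint (J (k + 1) ω) (s (k + 1) ω) - chainGradient f g (x (k + 1) ω) (u k ω)

/-- The error of `G` as an estimate of the inner function. -/
def valueNoise {Ω : Type*} {n m : ℕ} (g : Euc n → Euc m) (G : ℕ → Ω → Euc m)
    (x : ℕ → Ω → Euc n) (k : ℕ) (ω : Ω) : Euc m :=
  G (k + 1) ω - g (x (k + 1) ω)

theorem norm_adjoint_apply_sq_le {n m : ℕ} (J : Euc n →L[ℝ] Euc m) (s : Euc m) :
    ‖ContinuousLinearMap.adjoint J s‖ ^ 2 ≤ ‖s‖ ^ 2 * ‖J‖ ^ 2 := by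
  rw [← mul_pow, mul_comm]
  refine pow_le_pow_left₀ (norm_nonneg _) ((ContinuousLinearMap.le_opNorm _ _).trans_eq ?_) 2
  rw [LinearIsometryEquiv.norm_map]

namespace IsNASARun

variable {Ω : Type*} {n m : ℕ} {X : Set (Euc n)} {a b β : ℝ} {x0 z0 : Euc n} {u0 : Euc m}
  {τ : ℕ → Ω → ℝ} {G : ℕ → Ω → Euc m} {J : ℕ → Ω → (Euc n →L[ℝ] Euc m)} {s : ℕ → Ω → Euc m}
  {x y z : ℕ → Ω → Euc n} {u : ℕ → Ω → Euc m}

theorem measurable_y (h : IsNASARun X a b x0 z0 u0 (fun _ _ => β) τ G J s x y z u) (hβ : 0 < β)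
    (hconv : Convex ℝ X) (hclosed : IsClosed X) (k : ℕ) : Measurable[history x z u k] (y k) := by
  obtain ⟨π, hπ⟩ := exists_convex_projection ⟨x0, h.x0_mem⟩ hconv hclosed
  have hπc : Continuous π := by
    refine (LipschitzWith.of_dist_le_mul (K := 1) fun v v' => ?_).continuous
    rw [dist_eq_norm, dist_eq_norm, NNReal.coe_one, one_mul]
    exact norm_sub_le_of_projection_inequalities (hπ v).1 (hπ v').1 (hπ v).2 (hπ v').2
  have hy : y k = fun ω => π (x k ω - β⁻¹ • z k ω) := by
    ext1 ω
    exact (h.step_y k ω).eq_projection hconv hβ hπ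
  rw [hy]
  exact hπc.measurable.comp
    ((measurable_history_x le_rfl).sub ((measurable_history_z le_rfl).const_smul β⁻¹))

theorem measurable_x_succ (h : IsNASARun X a b x0 z0 u0 (fun _ _ => β) τ G J s x y z u)
    (hβ : 0 < β) (hconv : Convex ℝ X) (hclosed : IsClosed X) (k : ℕ) :
    Measurable[history x z u k] (x (k + 1)) := by
  rw [show x (k + 1) = fun ω => x k ω + τ k ω • (y k ω - x k ω) from funext (h.step_x k)]
  exact (measurable_history_x le_rfl).add
    ((h.τ_meas k).smul ((h.measurable_y hβ hconv hclosed k).sub (measurable_history_x le_rfl)))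

/-- The update of `z` can be solved for the oracle output, since `a τ k ≠ 0`; so the output is adapted
to the filtration generated by the iterates alone. -/
theorem measurable_transpose_succ (h : IsNASARun X a b x0 z0 u0 (fun _ _ => β) τ G J s x y z u)
    (k : ℕ) : Measurable[history x z u (k + 1)]
      fun ω => ContinuousLinearMap.adjoint (J (k + 1) ω) (s (k + 1) ω) := by
  have hτ : Measurable[history x z u (k + 1)] (τ k) :=
    (h.τ_meas k).mono (history_mono k.le_succ) le_rfl
  have heq : (fun ω => ContinuousLinearMap.adjoint (J (k + 1) ω) (s (k + 1) ω)) =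
      fun ω => (a * τ k ω)⁻¹ • (z (k + 1) ω - (1 - a * τ k ω) • z k ω) := by
    ext1 ω
    have hne : a * τ k ω ≠ 0 := (mul_pos h.a_pos (h.τ_pos k ω)).ne'
    rw [h.step_z k ω, add_sub_cancel_left, smul_smul, inv_mul_cancel₀ hne, one_smul]
  rw [heq]
  exact (hτ.const_mul a).inv.smul ((measurable_history_z le_rfl).sub
    (((hτ.const_mul a).const_sub 1).smul (measurable_history_z k.le_succ)))

theorem measurable_G_succ (h : IsNASARun X a b x0 z0 u0 (fun _ _ => β) τ G J s x y z u)
    (k : ℕ) : Measurable[history x z u (k + 1)] (G (k + 1)) := by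
  have hτ : Measurable[history x z u (k + 1)] (τ k) :=
    (h.τ_meas k).mono (history_mono k.le_succ) le_rfl
  have heq : G (k + 1) =
      fun ω => (b * τ k ω)⁻¹ • (u (k + 1) ω - (1 - b * τ k ω) • u k ω) := by
    ext1 ω
    have hne : b * τ k ω ≠ 0 := (mul_pos h.b_pos (h.τ_pos k ω)).ne'
    rw [h.step_u k ω, add_sub_cancel_left, smul_smul, inv_mul_cancel₀ hne, one_smul]
  rw [heq]
  exact (hτ.const_mul b).inv.smul ((measurable_history_u le_rfl).sub
    (((hτ.const_mul b).const_sub 1).smul (measurable_history_u k.le_succ)))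

/-- The iterates are measurable, by induction on `k`: the stepsize `τ k` is measurable with respect to
`history x z u k`, and so becomes measurable once the iterates up to time `k` are. -/
theorem history_le [mΩ : MeasurableSpace Ω]
    (h : IsNASARun X a b x0 z0 u0 (fun _ _ => β) τ G J s x y z u)
    (hβ : 0 < β) (hconv : Convex ℝ X) (hclosed : IsClosed X) (hG : ∀ k, Measurable (G (k + 1)))
    (hJ : ∀ k, Measurable (J (k + 1))) (hs : ∀ k, Measurable (s (k + 1))) (k : ℕ) :
    history x z u k ≤ mΩ := by
  have key : ∀ k, ∀ i ≤ k, Measurable (x i) ∧ Measurable (z i) ∧ Measurable (u i) := by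
    intro k
    induction k with
    | zero =>
      intro i hi
      obtain rfl := Nat.le_zero.1 hi
      rw [show x 0 = fun _ => x0 from funext h.init_x, show z 0 = fun _ => z0 from funext h.init_z,
        show u 0 = fun _ => u0 from funext h.init_u]
      exact ⟨measurable_const, measurable_const, measurable_const⟩
    | succ k ih =>
      intro i hi
      rcases Nat.le_succ_iff.1 hi with hi | rfl
      · exact ih i hi
      have hle : history x z u k ≤ mΩ := _root_.history_le (fun i hi => (ih i hi).1)
        (fun i hi => (ih i hi).2.1) (fun i hi => (ih i hi).2.2)
      have hτ : Measurable (τ k) := (h.τ_meas k).mono hle le_rfl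
      refine ⟨(h.measurable_x_succ hβ hconv hclosed k).mono hle le_rfl, ?_, ?_⟩
      · rw [show z (k + 1) = fun ω => (1 - a * τ k ω) • z k ω + (a * τ k ω) •
          ContinuousLinearMap.adjoint (J (k + 1) ω) (s (k + 1) ω) from funext (h.step_z k)]
        have hadj : Measurable fun ω =>
            ContinuousLinearMap.adjoint (J (k + 1) ω) (s (k + 1) ω) :=
          measurable_adjoint_apply (hJ k) (hs k)
        exact (((hτ.const_mul a).const_sub 1).smul (ih k le_rfl).2.1).add
          ((hτ.const_mul a).smul hadj)
      · rw [show u (k + 1) = fun ω => (1 - b * τ k ω) • u k ω + (b * τ k ω) • G (k + 1) ω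
          from funext (h.step_u k)]
        exact (((hτ.const_mul b).const_sub 1).smul (ih k le_rfl).2.2).add
          ((hτ.const_mul b).smul (hG k))
  exact _root_.history_le (fun i hi => (key k i hi).1) (fun i hi => (key k i hi).2.1)
    (fun i hi => (key k i hi).2.2)

end IsNASARun

namespace IsNASAOracle

variable {Ω : Type*} [mΩ : MeasurableSpace Ω] {P : Measure Ω} {n m : ℕ}
  {f : Euc m → ℝ} {g : Euc n → Euc m} {σG σJ σs : ℝ}
  {G : ℕ → Ω → Euc m} {J : ℕ → Ω → (Euc n →L[ℝ] Euc m)} {s : ℕ → Ω → Euc m}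
  {x z : ℕ → Ω → Euc n} {u : ℕ → Ω → Euc m} {Lf Lg Lf' Lg' : ℝ≥0}

theorem measurable_transpose (h : IsNASAOracle P f g σG σJ σs G J s x z u) (k : ℕ) :
    Measurable fun ω => ContinuousLinearMap.adjoint (J (k + 1) ω) (s (k + 1) ω) :=
  measurable_adjoint_apply (h.J_meas k) (h.s_meas k)

theorem memLp_valueNoise (h : IsNASAOracle P f g σG σJ σs G J s x z u) (k : ℕ) :
    MemLp (valueNoise g G x k) 2 P :=
  (h.G_memLp k).sub (((h.G_memLp k).condExp one_le_two).ae_eq (h.G_mean k))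

variable [IsProbabilityMeasure P]

theorem integrable_sq_mul_sq (h : IsNASAOracle P f g σG σJ σs G J s x z u) {k : ℕ}
    (hle : history x z u k ≤ mΩ) :
    Integrable (fun ω => ‖s (k + 1) ω‖ ^ 2 * ‖J (k + 1) ω‖ ^ 2) P :=
  ((h.condIndep k).comp (φ := fun v => ‖v‖ ^ 2) (ψ := fun A => ‖A‖ ^ 2)
    (measurable_norm.pow_const 2) (measurable_norm.pow_const 2)).integrable_mul hle
    ((h.s_meas k).norm.pow_const 2) ((h.J_meas k).norm.pow_const 2) (fun _ => sq_nonneg _)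
    (fun _ => sq_nonneg _) ((h.s_memLp k).integrable_norm_pow two_ne_zero)
    ((h.J_memLp k).integrable_norm_pow two_ne_zero) (h.J_sq k)

theorem memLp_transpose (h : IsNASAOracle P f g σG σJ σs G J s x z u) {k : ℕ}
    (hle : history x z u k ≤ mΩ) :
    MemLp (fun ω => ContinuousLinearMap.adjoint (J (k + 1) ω) (s (k + 1) ω)) 2 P := by
  have hm := h.measurable_transpose k
  rw [memLp_two_iff_integrable_sq_norm hm.aestronglyMeasurable]
  refine (h.integrable_sq_mul_sq hle).mono' (hm.norm.pow_const 2).aestronglyMeasurable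
    (ae_of_all _ fun ω => ?_)
  rw [Real.norm_of_nonneg (sq_nonneg _)]
  exact norm_adjoint_apply_sq_le _ _

theorem condExp_transpose (h : IsNASAOracle P f g σG σJ σs G J s x z u) {k : ℕ}
    (hle : history x z u k ≤ mΩ) :
    P[fun ω => ContinuousLinearMap.adjoint (J (k + 1) ω) (s (k + 1) ω) | history x z u k] =ᵐ[P]
      fun ω => chainGradient f g (x (k + 1) ω) (u k ω) := by
  have h1 := (h.condIndep k).condExp_bilin (transposeApply n m) hle (h.s_meas k) (h.J_meas k)
    ((h.s_memLp k).integrable one_le_two) ((h.J_memLp k).integrable one_le_two)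
    ((h.memLp_transpose hle).integrable one_le_two)
  refine h1.trans ?_
  filter_upwards [h.s_mean k, h.J_mean k] with ω h2 h3
  rw [h2, h3, transposeApply_apply, chainGradient]

theorem condExp_sq_mul_sq_le (h : IsNASAOracle P f g σG σJ σs G J s x z u) {k : ℕ}
    (hle : history x z u k ≤ mΩ) :
    P[fun ω => ‖s (k + 1) ω‖ ^ 2 * ‖J (k + 1) ω‖ ^ 2 | history x z u k] ≤ᵐ[P]
      fun _ => σs ^ 2 * σJ ^ 2 := by
  have hS : Measurable fun ω => ‖s (k + 1) ω‖ ^ 2 := (h.s_meas k).norm.pow_const 2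
  have hT : Measurable fun ω => ‖J (k + 1) ω‖ ^ 2 := (h.J_meas k).norm.pow_const 2
  have hind := (h.condIndep k).comp (φ := fun v => ‖v‖ ^ 2) (ψ := fun A => ‖A‖ ^ 2)
    (measurable_norm.pow_const 2) (measurable_norm.pow_const 2)
  have h1 := hind.condExp_bilin (ContinuousLinearMap.mul ℝ ℝ) hle hS hT
    ((h.s_memLp k).integrable_norm_pow two_ne_zero)
    ((h.J_memLp k).integrable_norm_pow two_ne_zero) (h.integrable_sq_mul_sq hle)
  have h0 : 0 ≤ᵐ[P] P[fun ω => ‖J (k + 1) ω‖ ^ 2 | history x z u k] :=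
    condExp_nonneg (ae_of_all _ fun ω => sq_nonneg _)
  filter_upwards [h1, h.s_sq k, h.J_sq k, h0] with ω h2 h3 h4 h5
  simp only [ContinuousLinearMap.mul_apply'] at h2
  rw [h2]
  exact mul_le_mul h3 h4 h5 (sq_nonneg _)

theorem memLp_chainGradient (hLf : LipschitzWith Lf f) (hLg : LipschitzWith Lg g) {k : ℕ}
    (hv : Measurable fun ω => chainGradient f g (x (k + 1) ω) (u k ω)) :
    MemLp (fun ω => chainGradient f g (x (k + 1) ω) (u k ω)) 2 P :=
  .of_bound hv.aestronglyMeasurable (Lg * Lf) (ae_of_all _ fun _ => norm_chainGradient_le hLf hLg _ _)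

theorem memLp_gradientNoise (h : IsNASAOracle P f g σG σJ σs G J s x z u) {k : ℕ}
    (hle : history x z u k ≤ mΩ) (hLf : LipschitzWith Lf f) (hLg : LipschitzWith Lg g)
    (hv : Measurable[history x z u k] fun ω => chainGradient f g (x (k + 1) ω) (u k ω)) :
    MemLp (gradientNoise f g J s x u k) 2 P :=
  (h.memLp_transpose hle).sub (memLp_chainGradient hLf hLg (hv.mono hle le_rfl))

theorem condExp_gradientNoise (h : IsNASAOracle P f g σG σJ σs G J s x z u) {k : ℕ}
    (hle : history x z u k ≤ mΩ) (hLf : LipschitzWith Lf f) (hLg : LipschitzWith Lg g)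
    (hv : Measurable[history x z u k] fun ω => chainGradient f g (x (k + 1) ω) (u k ω)) :
    P[gradientNoise f g J s x u k | history x z u k] =ᵐ[P] 0 := by
  have hvint := (memLp_chainGradient (P := P) hLf hLg (hv.mono hle le_rfl)).integrable one_le_two
  have h1 := condExp_sub ((h.memLp_transpose hle).integrable one_le_two) hvint (history x z u k)
  rw [condExp_of_stronglyMeasurable hle hv.stronglyMeasurable hvint] at h1
  refine EventuallyEq.trans h1 ?_
  filter_upwards [h.condExp_transpose hle] with ω hω
  rw [Pi.sub_apply, hω, sub_self, Pi.zero_apply]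

theorem condExp_norm_gradientNoise_sq_le (h : IsNASAOracle P f g σG σJ σs G J s x z u) {k : ℕ}
    (hle : history x z u k ≤ mΩ) (hLf : LipschitzWith Lf f) (hLg : LipschitzWith Lg g)
    (hv : Measurable[history x z u k] fun ω => chainGradient f g (x (k + 1) ω) (u k ω)) :
    P[fun ω => ‖gradientNoise f g J s x u k ω‖ ^ 2 | history x z u k] ≤ᵐ[P]
      fun _ => 2 * (σs ^ 2 * σJ ^ 2) + 2 * (Lg * Lf) ^ 2 := by
  have hint := (h.integrable_sq_mul_sq hle).const_mul 2
  have hc : Integrable (fun _ : Ω => 2 * ((Lg : ℝ) * Lf) ^ 2) P := integrable_const _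
  have h1 : P[fun ω => ‖gradientNoise f g J s x u k ω‖ ^ 2 | history x z u k] ≤ᵐ[P]
      P[(fun ω => 2 * (‖s (k + 1) ω‖ ^ 2 * ‖J (k + 1) ω‖ ^ 2)) +
        (fun _ => 2 * ((Lg : ℝ) * Lf) ^ 2) | history x z u k] := by
    refine condExp_mono ((h.memLp_gradientNoise hle hLf hLg hv).integrable_norm_pow two_ne_zero)
      (hint.add hc) (ae_of_all _ fun ω => ?_)
    have h2 := norm_sub_le (ContinuousLinearMap.adjoint (J (k + 1) ω) (s (k + 1) ω))
      (chainGradient f g (x (k + 1) ω) (u k ω))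
    have h3 := norm_adjoint_apply_sq_le (J (k + 1) ω) (s (k + 1) ω)
    have h4 := pow_le_pow_left₀ (norm_nonneg _)
      (norm_chainGradient_le hLf hLg (x (k + 1) ω) (u k ω)) 2
    have h5 := pow_le_pow_left₀ (norm_nonneg _) h2 2
    simp only [gradientNoise, Pi.add_apply]
    linarith [sq_nonneg (‖ContinuousLinearMap.adjoint (J (k + 1) ω) (s (k + 1) ω)‖ -
      ‖chainGradient f g (x (k + 1) ω) (u k ω)‖)]
  have h2 := condExp_add hint hc (history x z u k)
  have h3 := condExp_smul (μ := P) (2 : ℝ)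
    (fun ω => ‖s (k + 1) ω‖ ^ 2 * ‖J (k + 1) ω‖ ^ 2) (history x z u k)
  rw [condExp_const hle] at h2
  filter_upwards [h1, h2, h3, h.condExp_sq_mul_sq_le hle] with ω h1 h2 h3 h4
  refine h1.trans ?_
  rw [h2, Pi.add_apply]
  refine add_le_add (le_trans (le_of_eq h3) ?_) le_rfl
  simpa using h4

theorem condExp_valueNoise (h : IsNASAOracle P f g σG σJ σs G J s x z u) {k : ℕ}
    (hle : history x z u k ≤ mΩ)
    (hv : Measurable[history x z u k] fun ω => g (x (k + 1) ω)) :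
    P[valueNoise g G x k | history x z u k] =ᵐ[P] 0 := by
  have hvint : Integrable (fun ω => g (x (k + 1) ω)) P := integrable_condExp.congr (h.G_mean k)
  have h1 := condExp_sub ((h.G_memLp k).integrable one_le_two) hvint (history x z u k)
  rw [condExp_of_stronglyMeasurable hle hv.stronglyMeasurable hvint] at h1
  refine EventuallyEq.trans h1 ?_
  filter_upwards [h.G_mean k] with ω hω
  rw [Pi.sub_apply, hω, sub_self, Pi.zero_apply]

end IsNASAOracle

theorem tendsto_sum_range_of_sum_Icc {τ : ℕ → ℝ}
    (h : Tendsto (fun N : ℕ => ∑ k ∈ Finset.Icc 1 N, τ k) atTop atTop) :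
    Tendsto (fun N => ∑ k ∈ Finset.range N, τ k) atTop atTop := by
  rw [← tendsto_add_atTop_iff_nat 1]
  refine (tendsto_atTop_add_const_left atTop (τ 0) h).congr fun N => ?_
  rw [Finset.range_eq_Ico, Finset.sum_eq_sum_Ico_succ_bot N.succ_pos]
  rfl

/-- The conclusion for almost every outcome; the convergence of the noise series is verified in two
rounds, since the square summability of the weights `τ k • (y k - x k)` uses the boundedness of the
trajectory, which in turn rests on the convergence of `∑ τ k • ξ k` and `∑ τ k • ζ k`. -/
theorem stationary_ae {n m : ℕ} {X : Set (Euc n)} (hconv : Convex ℝ X) (hclosed : IsClosed X)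
    {f : Euc m → ℝ} {g : Euc n → Euc m} (hf : ContDiff ℝ 1 f) (hg : ContDiff ℝ 1 g)
    {Lf Lg Lf' Lg' : ℝ≥0} (hLf : LipschitzWith Lf f) (hLg : LipschitzWith Lg g)
    (hLf' : LipschitzWith Lf' (gradient f)) (hLg' : LipschitzWith Lg' (fderiv ℝ g))
    {a b β c γ : ℝ} (hβ : 0 < β) (hc : 0 < c) (hγ : 0 < γ) (hc1 : c ≤ a * β) (hc2 : 2 * c ≤ γ * b)
    (hcond : (Lg : ℝ) ^ 2 * (a * Lf' + γ) ^ 2 ≤ 2 * (a * β - c) * (γ * b - 2 * c))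
    {Ω : Type*} [mΩ : MeasurableSpace Ω] {P : Measure Ω} [IsProbabilityMeasure P]
    {x0 z0 : Euc n} {u0 : Euc m} {τ : ℕ → Ω → ℝ} {G : ℕ → Ω → Euc m}
    {J : ℕ → Ω → (Euc n →L[ℝ] Euc m)} {s : ℕ → Ω → Euc m} {x y z : ℕ → Ω → Euc n}
    {u : ℕ → Ω → Euc m} {σG σJ σs : ℝ}
    (hrun : IsNASARun X a b x0 z0 u0 (fun _ _ => β) τ G J s x y z u)
    (horacle : IsNASAOracle P f g σG σJ σs G J s x z u)
    (hτsum : ∀ᵐ ω ∂P, Tendsto (fun N : ℕ => ∑ k ∈ Finset.Icc 1 N, τ k ω) atTop atTop)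
    (hτsq : ∫⁻ ω, ∑' k : ℕ, ENNReal.ofReal (τ (k + 1) ω ^ 2) ∂P < ∞) :
    ∀ᵐ ω ∂P, ∀ (xs zs : Euc n) (us : Euc m),
      MapClusterPt (xs, zs, us) atTop (fun k : ℕ => (x k ω, z k ω, u k ω)) →
        zs = chainGradient f g xs (g xs) ∧ us = g xs ∧ -zs ∈ normalCone X xs := by
  have ha := hrun.a_pos
  have hb := hrun.b_pos
  have hle : ∀ k, history x z u k ≤ mΩ := hrun.history_le hβ hconv hclosed horacle.G_meas
    horacle.J_meas horacle.s_meas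
  set ℱ : Filtration ℕ mΩ := ⟨history x z u, history_mono, hle⟩ with hℱ
  have hτm : ∀ k, Measurable[history x z u k] (τ k) := hrun.τ_meas
  have hxm : ∀ k, Measurable[history x z u k] (x (k + 1)) :=
    hrun.measurable_x_succ hβ hconv hclosed
  have hgm : ∀ k, Measurable[history x z u k] fun ω => g (x (k + 1) ω) := fun k =>
    hg.continuous.measurable.comp (hxm k)
  have hvm : ∀ k, Measurable[history x z u k] fun ω => chainGradient f g (x (k + 1) ω) (u k ω) :=
    fun k => measurable_chainGradient hLf'.continuous hLg'.continuous (hxm k)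
      (measurable_history_u le_rfl)
  have hdm : ∀ k, Measurable[history x z u k] fun ω => τ k ω • (y k ω - x k ω) := fun k =>
    (hτm k).smul ((hrun.measurable_y hβ hconv hclosed k).sub (measurable_history_x le_rfl))
  have hqm : ∀ k, Measurable[history x z u k]
      fun ω => ((1 - b * τ k ω) * τ k ω) • (g (x (k + 1) ω) - u k ω) := fun k =>
    ((((hτm k).const_mul b).const_sub 1).mul (hτm k)).smul
      ((hgm k).sub (measurable_history_u le_rfl))
  set ξ := gradientNoise f g J s x u with hξ
  set ζ := valueNoise g G x with hζ
  have hξm : ∀ k, Measurable[history x z u (k + 1)] (ξ k) := fun k =>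
    (hrun.measurable_transpose_succ k).sub ((hvm k).mono (history_mono k.le_succ) le_rfl)
  have hζm : ∀ k, Measurable[history x z u (k + 1)] (ζ k) := fun k =>
    (hrun.measurable_G_succ k).sub ((hgm k).mono (history_mono k.le_succ) le_rfl)
  have hξ2 : ∀ k, MemLp (ξ k) 2 P := fun k =>
    horacle.memLp_gradientNoise (hle k) hLf hLg (hvm k)
  have hζ2 : ∀ k, MemLp (ζ k) 2 P := horacle.memLp_valueNoise
  have hξmean : ∀ k, P[ξ k | history x z u k] =ᵐ[P] 0 := fun k =>
    horacle.condExp_gradientNoise (hle k) hLf hLg (hvm k)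
  have hζmean : ∀ k, P[ζ k | history x z u k] =ᵐ[P] 0 := fun k =>
    horacle.condExp_valueNoise (hle k) (hgm k)
  have hξvar := fun k => horacle.condExp_norm_gradientNoise_sq_le (hle k) hLf hLg (hvm k)
  have hζvar : ∀ k, P[fun ω => ‖ζ k ω‖ ^ 2 | history x z u k] ≤ᵐ[P] fun _ => σG ^ 2 :=
    horacle.G_var
  have hτbd : ∀ k ω, τ k ω ^ 2 ≤ (1 / a) ^ 2 := fun k ω =>
    pow_le_pow_left₀ (hrun.τ_pos k ω).le (hrun.τ_le k ω) 2
  have hsq : ∀ᵐ ω ∂P, Summable fun k => τ k ω ^ 2 := by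
    filter_upwards [ae_summable_of_lintegral_lt_top
      (fun k => ((hτm (k + 1)).mono (hle _) le_rfl).pow_const 2) (fun k ω => sq_nonneg _) hτsq]
      with ω hω
    exact (summable_nat_add_iff (f := fun k => τ k ω ^ 2) 1).1 hω
  have hξsq : ∀ᵐ ω ∂P, Summable fun k => τ k ω ^ 2 * ‖ξ k ω‖ ^ 2 := by
    filter_upwards [ae_summable_mul_of_condExp_le (fun k => hle (k + 1))
      (fun k => ((hτm (k + 1)).pow_const 2).stronglyMeasurable) (fun k ω => sq_nonneg _)
      (fun k ω => hτbd (k + 1) ω)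
      (fun k => ((hξm (k + 1)).mono (hle _) le_rfl).norm.pow_const 2) (fun k ω => sq_nonneg _)
      (fun k => (hξ2 (k + 1)).integrable_norm_pow two_ne_zero) (fun k => hξvar (k + 1)) hτsq]
      with ω hω
    exact (summable_nat_add_iff (f := fun k => τ k ω ^ 2 * ‖ξ k ω‖ ^ 2) 1).1 hω
  have hζsq : ∀ᵐ ω ∂P, Summable fun k => τ k ω ^ 2 * ‖ζ k ω‖ ^ 2 := by
    filter_upwards [ae_summable_mul_of_condExp_le (fun k => hle (k + 1))
      (fun k => ((hτm (k + 1)).pow_const 2).stronglyMeasurable) (fun k ω => sq_nonneg _)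
      (fun k ω => hτbd (k + 1) ω)
      (fun k => ((hζm (k + 1)).mono (hle _) le_rfl).norm.pow_const 2) (fun k ω => sq_nonneg _)
      (fun k => (hζ2 (k + 1)).integrable_norm_pow two_ne_zero) (fun k => hζvar (k + 1)) hτsq]
      with ω hω
    exact (summable_nat_add_iff (f := fun k => τ k ω ^ 2 * ‖ζ k ω‖ ^ 2) 1).1 hω
  have hpath : ∀ᵐ ω ∂P, IsNASAPath X f g a b β (fun k => τ k ω) (fun k => x k ω)
      (fun k => y k ω) (fun k => z k ω) (fun k => u k ω) (fun k => ξ k ω) (fun k => ζ k ω) := by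
    filter_upwards [hτsum, hsq,
      ae_exists_tendsto_sum_smul ℱ (fun k => (hτm k).stronglyMeasurable)
        (fun k => (hξm k).stronglyMeasurable) hξ2 hξmean hξvar hsq,
      ae_exists_tendsto_sum_smul ℱ (fun k => (hτm k).stronglyMeasurable)
        (fun k => (hζm k).stronglyMeasurable) hζ2 hζmean hζvar hsq] with ω h1 h2 h3 h4
    exact
      { a_pos := ha
        b_pos := hb
        β_pos := hβ
        τ_pos := fun k => hrun.τ_pos k ω
        τ_le := fun k => hrun.τ_le k ω
        tendsto_sum_τ := tendsto_sum_range_of_sum_Icc h1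
        summable_τ_sq := h2
        step_y := fun k => hrun.step_y k ω
        step_x := fun k => hrun.step_x k ω
        step_z := fun k => by
          rw [hrun.step_z k ω, hξ, gradientNoise, add_sub_cancel]
        step_u := fun k => by
          rw [hrun.step_u k ω, hζ, valueNoise, add_sub_cancel]
        noise_z := h3
        noise_u := h4 }
  have hdξ := ae_exists_tendsto_sum_inner ℱ (fun k => (hdm k).stronglyMeasurable)
    (fun k => (hξm k).stronglyMeasurable) hξ2 hξmean hξvar (by
      filter_upwards [hpath, hsq] with ω h1 h2
      obtain ⟨B, -, hB⟩ := h1.exists_bound hconv hclosed hLf hLg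
      refine Summable.of_nonneg_of_le (fun k => sq_nonneg _) (fun k => ?_) (h2.mul_right (B ^ 2))
      rw [norm_smul, mul_pow, Real.norm_eq_abs, sq_abs]
      gcongr
      exact (hB k).2.1)
  have hqζ := ae_exists_tendsto_sum_inner ℱ (fun k => (hqm k).stronglyMeasurable)
    (fun k => (hζm k).stronglyMeasurable) hζ2 hζmean hζvar (by
      filter_upwards [hpath, hsq] with ω h1 h2
      obtain ⟨B, -, hB⟩ := h1.exists_bound hconv hclosed hLf hLg
      refine Summable.of_nonneg_of_le (fun k => sq_nonneg _) (fun k => ?_)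
        (h2.mul_left ((1 + b * (1 / a)) ^ 2 * B ^ 2))
      rw [norm_smul, mul_pow, Real.norm_eq_abs, sq_abs, mul_pow]
      have h3 : (1 - b * τ k ω) ^ 2 ≤ (1 + b * (1 / a)) ^ 2 := by
        have h4 : b * τ k ω ≤ b * (1 / a) := mul_le_mul_of_nonneg_left (hrun.τ_le k ω) hb.le
        have h5 : 0 < b * τ k ω := mul_pos hb (hrun.τ_pos k ω)
        exact sq_le_sq' (by linarith) (by linarith)
      calc _ ≤ (1 + b * (1 / a)) ^ 2 * τ k ω ^ 2 * B ^ 2 := by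
            gcongr
            exact (hB k).2.2.2
        _ = _ := by ring)
  filter_upwards [hpath, hξsq, hζsq, hdξ, hqζ] with ω h1 h2 h3 h4 h5 xs zs us hcl
  simp only [real_inner_smul_left] at h4 h5
  exact h1.stationary_of_mapClusterPt hconv hclosed hf hg hLf hLg hLf' hLg' hc hγ hc1 hc2 hcond
    h2 h3 h4 h5 hcl

theorem theorem3p3 {n m : ℕ} (X : Set (Euc n)) (hXconv : Convex ℝ X) (hXclosed : IsClosed X)
    (f : Euc m → ℝ) (g : Euc n → Euc m) (hf : ContDiff ℝ 1 f) (hg : ContDiff ℝ 1 g)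
    (Lf Lg Lf' Lg' : ℝ≥0) (hLf : LipschitzWith Lf f) (hLg : LipschitzWith Lg g)
    (hLf' : LipschitzWith Lf' (gradient f)) (hLg' : LipschitzWith Lg' (fderiv ℝ g)) :
    ∃ abar : ℝ, 0 < abar ∧ ∀ a : ℝ, 0 < a → a < abar →
      ∀ b β : ℝ, 0 < b → 0 < β →
      -- the condition on the parameters
      ∀ c γ : ℝ, 0 < c → 0 < γ → c ≤ a * β → 2 * c ≤ γ * b →
        (Lg : ℝ) ^ 2 * (a * Lf' + γ) ^ 2 ≤ 2 * (a * β - c) * (γ * b - 2 * c) →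
      ∀ (Ω : Type*) [MeasurableSpace Ω] (P : Measure Ω) [IsProbabilityMeasure P]
        (x0 z0 : Euc n) (u0 : Euc m) (τ : ℕ → Ω → ℝ)
        (G : ℕ → Ω → Euc m) (J : ℕ → Ω → (Euc n →L[ℝ] Euc m)) (s : ℕ → Ω → Euc m)
        (x y z : ℕ → Ω → Euc n) (u : ℕ → Ω → Euc m) (σG σJ σs : ℝ),
        IsNASARun X a b x0 z0 u0 (fun _ _ => β) τ G J s x y z u →
        IsNASAOracle P f g σG σJ σs G J s x z u →
        (∀ᵐ ω ∂P, Tendsto (fun N : ℕ => ∑ k ∈ Finset.Icc 1 N, τ k ω) atTop atTop) →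
        ∫⁻ ω, ∑' k : ℕ, ENNReal.ofReal (τ (k + 1) ω ^ 2) ∂P < ∞ →
        ∀ᵐ ω ∂P, ∀ (xs zs : Euc n) (us : Euc m),
          MapClusterPt (xs, zs, us) atTop (fun k : ℕ => (x k ω, z k ω, u k ω)) →
            zs = (ContinuousLinearMap.adjoint (fderiv ℝ g xs)) (gradient f (g xs)) ∧
            us = g xs ∧
            -zs ∈ normalCone X xs := by
  -- the condition on `a, b, β` is all that is needed: the argument works for every `a > 0`
  refine ⟨1, one_pos, ?_⟩
  intro a _ _ b β _ hβ c γ hc hγ hc1 hc2 hcond Ω _ P _ x0 z0 u0 τ G J s x y z u σG σJ σs hrun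
    horacle hτsum hτsq
  exact stationary_ae hXconv hXclosed hf hg hLf hLg hLf' hLg' hβ hc hγ hc1 hc2 hcond hrun horacle
    hτsum hτsq
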